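/- Let $\mu,\nu$ be probability measures on $\mathbb{R}^d$ with finite second moments, in convex order, i.e. $\int\phi\,d\mu\le\int\phi\,d\nu$ for all convex $\phi:\mathbb{R}^d\to\mathbb{R}$. Assume (H1) $\int e^{q|y|}\,\nu(dy)<\infty$ for all $q\ge 0$; (H2) $\nu$ is not concentrated on any hyperplane. Let $\mathsf{Cpl}$ denote the set of couplings, $\mathsf{MT}(\mu,\nu)$ the set of martingale couplings of $\mu$ and $\nu$, $H(\cdot|\cdot)$ relative entropy, and $\mathrm{MCov}(\eta,\mu)=\sup_{\kappa\in\mathsf{Cpl}(\eta,\mu)}\int \bar x\cdot x\,\kappa(d\bar x,dx)$. Consider the problems $$\text{(P)}\quad \inf_{m\in\mathsf{MT}(\mu,\nu)}H(m|\mu\otimes\nu),\qquad SP(\eta,\nu)\quad \inf_{\pi\in\mathsf{Cpl}(\eta,\nu)}\Big[H(\pi|\eta\otimes\nu)-\int\bar x\cdot y\,\pi(d\bar x,dy)\Big],$$ $$\text{(VP)}\quad \sup_{\eta\in\mathcal P_2(\mathbb{R}^d)}\big\{SP(\eta,\nu)+\mathrm{MCov}(\eta,\mu)\big\},$$ $$\text{(D)}\quad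 \sup_{\psi\in C_b(\mathbb{R}^d)}\mathcal D(\psi),\qquad \mathcal D(\psi)=\int\psi\,d\nu+\int\sup_{h\in\mathbb{R}^d}\Big[h\cdot x-\log\int e^{h\cdot y+\psi(y)}\nu(dy)\Big]\mu(dx).$$ Suppose (VP) has finite value and is attained by $\bar\mu\in\mathcal P_2(\mathbb{R}^d)$. Let $\pi$ be the solution of $SP(\bar\mu,\nu)$ and let $(\bar\varphi,\psi)$ be the associated Schrödinger potentials, i.e. measurable functions with $$\int e^{\bar\varphi(\bar x)+\psi(y)+\bar x\cdot y}\nu(dy)=1\ \ (\bar\mu\text{-a.e. }\bar x),\qquad \int e^{\bar\varphi(\bar x)+\psi(y)+\bar x\cdot y}\bar\mu(d\bar x)=1\ \ (\nu\text{-a.e. }y),$$ where $\bar\varphi$ is extended to all of $\mathbb{R}^d$ by $\bar\varphi(\bar x)=-\log\int e^{\psi(y)+\bar x\cdot y}\nu(dy)$. For every $\bar x\in\mathbb{R}^d$ let $\pi_{\bar x}$ be the probability measure with $\nu$-density $e^{\psi(y)+\bar x\cdot y}/\int e^{\psi(z)+\bar x\cdot z}\nu(dz)$, let $T(\bar x)=\int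 y\,\pi_{\bar x}(dy)$, and let $m=(T,\mathrm{id})_\#\pi$. Then $(\pi_{\bar x})$ is well defined and is a version of the disintegration of $\pi$ with respect to its first marginal $\bar\mu$, and: (1) $\bar\varphi$ is finite, strictly concave and infinitely differentiable on $\mathbb{R}^d$, with $-\nabla\bar\varphi(\bar x)=T(\bar x)$ and $\nabla^2\bar\varphi(\bar x)=-\mathrm{Cov}(\pi_{\bar x})$ for all $\bar x\in\mathbb{R}^d$, where $\mathrm{Cov}(\pi_{\bar x})$ is the (finite) covariance matrix of $\pi_{\bar x}$; moreover $T$ is injective and $T_\#\bar\mu=\mu$. (2) With $h:T(\mathbb{R}^d)\to\mathbb{R}^d$ the inverse of $T$, the disintegration of $m$ with respect to its first marginal $\mu$ satisfies $m_x=\pi_{h(x)}$ for $\mu$-a.e. $x$. (3) $m$ attains (P). (4) $\psi$ attains (D), that is: $\psi$ is $\nu$-integrable (possibly unbounded), $\mathcal D(\psi)$ equals the value $\sup_{C_b(\mathbb{R}^d)}\mathcal D$ of (D), and $\mathcal D(\psi')\le\mathcal D(\psi)$ for every $\nu$-integrable $\psi'$. Moreover, for $\mu$-a.e. $x$, $h(x)$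 is the unique maximizer of $$(I_x)\quad \sup_{h\in\mathbb{R}^d}\Big\{h\cdot x-\log\int e^{\psi(y)+h\cdot y}\nu(dy)\Big\}.$$ -/

import Mathlib

open MeasureTheory ProbabilityTheory InformationTheory Set
open scoped ENNReal RealInnerProductSpace ContDiff BoundedContinuousFunction

namespace MartingaleSB

/-- The Euclidean space `ℝ^d`. -/
abbrev Rd (d : ℕ) : Type := EuclideanSpace ℝ (Fin d)

variable {d : ℕ}

/-- `μ ∈ 𝒫₂(ℝ^d)`: a probability measure with finite second moment. -/
def IsP2 (μ : Measure (Rd d)) : Prop :=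
  IsProbabilityMeasure μ ∧ MemLp (fun x : Rd d => x) 2 μ

/-- Convex order. A finite convex function has a `ν`-integral in `(-∞, ∞]` (for `ν` with a first
moment), so the inequality `∫ φ dμ ≤ ∫ φ dν` has content exactly when `φ` is `ν`-integrable, and
then it says that `φ` is `μ`-integrable as well and that the integrals are ordered. -/
def ConvexOrder (μ ν : Measure (Rd d)) : Prop :=
  ∀ φ : Rd d → ℝ, ConvexOn ℝ univ φ → Integrable φ ν →
    Integrable φ μ ∧ ∫ x, φ x ∂μ ≤ ∫ x, φ x ∂ν

/-- All exponential moments are finite. -/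
def HasExpMoments (ν : Measure (Rd d)) : Prop :=
  ∀ q : ℝ, 0 ≤ q → Integrable (fun y : Rd d => Real.exp (q * ‖y‖)) ν

/-- The measure is not concentrated on any hyperplane `{y | u · y = c}`, `u ≠ 0`. -/
def NotOnHyperplane (ν : Measure (Rd d)) : Prop :=
  ∀ (u : Rd d) (c : ℝ), u ≠ 0 → ¬ ∀ᵐ y ∂ν, ⟪u, y⟫ = c

/-- `π ∈ Cpl(μ, ν)`. -/
def IsCoupling (μ ν : Measure (Rd d)) (π : Measure (Rd d × Rd d)) : Prop :=
  π.fst = μ ∧ π.snd = ν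

/-- `m ∈ MT(μ, ν)`: a coupling with `E_m[Y | X] = X`. -/
def IsMartingaleCoupling (μ ν : Measure (Rd d)) (m : Measure (Rd d × Rd d)) : Prop :=
  IsCoupling μ ν m ∧
    m[(Prod.snd : Rd d × Rd d → Rd d) |
      MeasurableSpace.comap (Prod.fst : Rd d × Rd d → Rd d) inferInstance] =ᵐ[m] Prod.fst

/-- `m` attains the problem `inf_{m ∈ MT(μ, ν)} H(m | μ ⊗ ν)`. -/
def AttainsP (μ ν : Measure (Rd d)) (m : Measure (Rd d × Rd d)) : Prop :=
  IsMartingaleCoupling μ ν m ∧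
    ∀ m' : Measure (Rd d × Rd d), IsMartingaleCoupling μ ν m' →
      klDiv m (μ.prod ν) ≤ klDiv m' (μ.prod ν)

/-- `MCov(η, μ)`, the supremum of `∫ x̄ · x dκ` over the couplings `κ` of `η` and `μ`. -/
noncomputable def mcov (η μ : Measure (Rd d)) : EReal :=
  ⨆ (κ : Measure (Rd d × Rd d)) (_ : IsCoupling η μ κ),
    ((∫ p, ⟪p.1, p.2⟫ ∂κ : ℝ) : EReal)

/-- The objective `H(π | η ⊗ ν) - ∫ x̄ · y dπ` of the Schrödinger problem between `η` and `ν`. -/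
noncomputable def spCost (η ν : Measure (Rd d)) (π : Measure (Rd d × Rd d)) : EReal :=
  (klDiv π (η.prod ν) : EReal) - ((∫ p, ⟪p.1, p.2⟫ ∂π : ℝ) : EReal)

/-- The value of the Schrödinger problem between `η` and `ν`. -/
noncomputable def spValue (η ν : Measure (Rd d)) : EReal :=
  ⨅ (π : Measure (Rd d × Rd d)) (_ : IsCoupling η ν π), spCost η ν π

/-- `π` is a solution of the Schrödinger problem between `η` and `ν`. -/
def SolvesSP (η ν : Measure (Rd d)) (π : Measure (Rd d × Rd d)) : Prop :=
  IsCoupling η ν π ∧ spCost η ν π = spValue η ν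

/-- The functional that the variational problem maximizes over `η ∈ 𝒫₂(ℝ^d)`. -/
noncomputable def vpFun (μ ν η : Measure (Rd d)) : EReal :=
  spValue η ν + mcov η μ

/-- The value of the variational problem. -/
noncomputable def vpValue (μ ν : Measure (Rd d)) : EReal :=
  ⨆ (η : Measure (Rd d)) (_ : IsP2 η), vpFun μ ν η

/-- `η ∈ 𝒫₂(ℝ^d)` attains the variational problem. -/
def SolvesVP (μ ν η : Measure (Rd d)) : Prop :=
  IsP2 η ∧ vpFun μ ν η = vpValue μ ν

/-- `(φ, ψ)` solves the Schrödinger system of `(η, ν)`. -/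
structure IsSchrodingerPotentials (η ν : Measure (Rd d)) (φ ψ : Rd d → ℝ) : Prop where
  measurable_left : Measurable φ
  measurable_right : Measurable ψ
  ss1 : ∀ᵐ x ∂η, ∫⁻ y, ENNReal.ofReal (Real.exp (φ x + ψ y + ⟪x, y⟫)) ∂ν = 1
  ss2 : ∀ᵐ y ∂ν, ∫⁻ x, ENNReal.ofReal (Real.exp (φ x + ψ y + ⟪x, y⟫)) ∂η = 1

/-- The log-partition function `log ∫ exp(ψ(y) + h · y) ν(dy) ∈ [-∞, ∞]`. -/
noncomputable def logPartition (ν : Measure (Rd d)) (ψ : Rd d → ℝ) (h : Rd d) : EReal :=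
  ENNReal.log (∫⁻ y, ENNReal.ofReal (Real.exp (ψ y + ⟪h, y⟫)) ∂ν)

/-- The extension of the first potential to all of `ℝ^d` for which the first equation of the
Schrödinger system, `∫ exp(φ̄(x̄) + ψ(y) + x̄ · y) ν(dy) = 1`, holds everywhere. A priori it takes
values in `[-∞, ∞]`. -/
noncomputable def extPotential (ν : Measure (Rd d)) (ψ : Rd d → ℝ) (x : Rd d) : EReal :=
  -logPartition ν ψ x

/-- The version of the disintegration `x̄ ↦ π_x̄` of the Schrödinger coupling that is defined for
every `x̄`: the probability measure with `ν`-density proportional to `exp(ψ(y) + x̄ · y)`. -/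
noncomputable def gibbs (ν : Measure (Rd d)) (ψ : Rd d → ℝ) (x : Rd d) : Measure (Rd d) :=
  ν.tilted (fun y => ψ y + ⟪x, y⟫)

/-- The barycentric map `T(x̄) = ∫ y π_x̄(dy)`. -/
noncomputable def baryMap (ν : Measure (Rd d)) (ψ : Rd d → ℝ) (x : Rd d) : Rd d :=
  ∫ y, y ∂(gibbs ν ψ x)

/-- The image `(T, id)_# π`. -/
noncomputable def baryPlan (T : Rd d → Rd d) (π : Measure (Rd d × Rd d)) :
    Measure (Rd d × Rd d) :=
  π.map (fun p => (T p.1, p.2))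

instance (T : Rd d → Rd d) (π : Measure (Rd d × Rd d)) [IsFiniteMeasure π] :
    IsFiniteMeasure (baryPlan T π) :=
  inferInstanceAs (IsFiniteMeasure (π.map (fun p => (T p.1, p.2))))

/-- The objective `h ↦ h · x - log ∫ exp(ψ(y) + h · y) ν(dy)` of the inner problem at `x`. -/
noncomputable def innerObj (ν : Measure (Rd d)) (ψ : Rd d → ℝ) (x h : Rd d) : EReal :=
  ((⟪h, x⟫ : ℝ) : EReal) - logPartition ν ψ h

/-- The integral of an extended-real function, positive part minus negative part. -/
noncomputable def eintegral (μ : Measure (Rd d)) (f : Rd d → EReal) : EReal :=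
  ((∫⁻ x, (f x).toENNReal ∂μ : ℝ≥0∞) : EReal) - ((∫⁻ x, (-f x).toENNReal ∂μ : ℝ≥0∞) : EReal)

/-- The dual functional `∫ ψ dν + ∫ sup_h [h · x - log ∫ exp(h · y + ψ(y)) ν(dy)] μ(dx)`, for
`ν`-integrable `ψ`. -/
noncomputable def dualFun (μ ν : Measure (Rd d)) (ψ : Rd d → ℝ) : EReal :=
  ((∫ y, ψ y ∂ν : ℝ) : EReal) + eintegral μ (fun x => ⨆ h : Rd d, innerObj ν ψ x h)

/-- The value of the dual problem: the supremum of the dual functional over `C_b(ℝ^d)`. -/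
noncomputable def dualValue (μ ν : Measure (Rd d)) : EReal :=
  ⨆ ψ : Rd d →ᵇ ℝ, dualFun μ ν ψ

/-- `ψ` attains the dual problem: it is `ν`-integrable (but possibly unbounded), its dual value is
the supremum over `C_b(ℝ^d)`, and no `ν`-integrable function does better. -/
def AttainsD (μ ν : Measure (Rd d)) (ψ : Rd d → ℝ) : Prop :=
  Integrable ψ ν ∧ dualFun μ ν ψ = dualValue μ ν ∧
    ∀ ψ' : Rd d → ℝ, Integrable ψ' ν → dualFun μ ν ψ' ≤ dualFun μ ν ψ

end MartingaleSB

/-!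
The function `logZ ν ψ` is the logarithm of the Laplace transform of `exp ψ • ν`, and the barycentric
map `T = baryMap ν ψ` is its gradient. The Schrödinger system bounds `ψ` from above by a function of
linear growth (`exists_growth_of_lintegral_eq_one`); since `ν` has all exponential moments, `logZ` is
finite and smooth everywhere, its derivatives are the moments of the Gibbs measures, and it satisfies
a strict gradient inequality because `ν` charges no hyperplane fully
(`Admissible.logZ_add_inner_lt`). Strict concavity of the potential, injectivity of `T` and
uniqueness in the inner problem all follow from that inequality.

The Gibbs plan, with density `exp (ψ y + x · y - logZ x)` with respect to `η ⊗ ν`, is a coupling of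
`η` and `ν` by the Schrödinger system. Both potentials are integrable
(`IsSchrodingerPotentials.integrable`), so the cost of a coupling is a constant plus its relative
entropy with respect to the Gibbs plan, which is therefore the unique solution of the Schrödinger
problem (`SolvesSP.eq_compProd`).

The constant `∫ ψ dν - ∫ logZ dη'` is a lower bound for the value of the Schrödinger problem from any
`η'`, with equality at the maximizer `η` of the variational problem. Thus `η` also maximizes
`∫ x̄ · x dκ - ∫ logZ dη'` over `η'` and over the couplings `κ` of `η'` and `μ`. The first-order
condition for displacements of `η` is `x = T x̄`. It is applied to couplings of nearly maximal
covariance, for which it holds approximately in probability, so that no optimal coupling is needed;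
in the limit it gives `T_# η = μ` (`SolvesVP.map_baryMap`).

With `h` a measurable left inverse of `T`, the plan `m = (T, id)_# π` disintegrates as
`μ ⊗ gibbs (h x)`, and `gibbs (h x)` has barycenter `x`, so that `m` is a martingale coupling. Its
logarithmic density `ψ y + h x · y - logZ (h x)` has the same mean under all martingale couplings
(`OptimalPotential.integral_exponent`), and the Gibbs variational inequality makes `m` optimal. The
common mean is the dual value of `ψ`. Jensen's inequality for the Gibbs measures bounds the dual
value of every integrable potential by it (`OptimalPotential.dualFun_le`), and an approximation of
`ψ` by bounded continuous functions shows that it is the supremum over those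
(`OptimalPotential.dualFun_le_dualValue`).
-/

namespace MartingaleSB

variable {d : ℕ}

/-! ### Exponential families with a potential of linear growth -/

/-- A measurable potential that grows at most linearly from above, with respect to a probability
measure all of whose exponential moments are finite. For such a potential the exponential family
`gibbs ν ψ` is defined on the whole space. -/
structure Admissible (ν : Measure (Rd d)) (ψ : Rd d → ℝ) : Prop where
  prob : IsProbabilityMeasure ν
  expMoments : HasExpMoments ν
  measurable : Measurable ψ
  growth : ∃ C K : ℝ, 0 ≤ C ∧ 0 ≤ K ∧ ∀ᵐ y ∂ν, ψ y ≤ C + K * ‖y‖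

/-- A strongly measurable function that grows at most exponentially. Such a
function, for instance a polynomial in the coordinates, is integrable against every Gibbs measure of
an admissible potential. -/
def ExpGrowth {E : Type} [NormedAddCommGroup E] (F : Rd d → E) : Prop :=
  StronglyMeasurable F ∧ ∃ A B : ℝ, 0 ≤ A ∧ 0 ≤ B ∧ ∀ y, ‖F y‖ ≤ A * Real.exp (B * ‖y‖)

/-- The real-valued log-partition function; it agrees with `logPartition` for admissible
potentials. -/
noncomputable def logZ (ν : Measure (Rd d)) (ψ : Rd d → ℝ) (x : Rd d) : ℝ :=
  Real.log (∫ y, Real.exp (ψ y + ⟪x, y⟫) ∂ν)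

section Growth

variable {E : Type} [NormedAddCommGroup E]

lemma expGrowth_const (c : E) : ExpGrowth (fun _ : Rd d => c) :=
  ⟨stronglyMeasurable_const, ‖c‖, 0, norm_nonneg _, le_rfl, fun y => by simp⟩

lemma norm_le_exp_norm (y : Rd d) : ‖y‖ ≤ Real.exp ‖y‖ := by
  linarith [Real.add_one_le_exp ‖y‖]

lemma expGrowth_id : ExpGrowth (fun y : Rd d => y) :=
  ⟨stronglyMeasurable_id, 1, 1, zero_le_one, zero_le_one, fun y => by
    simpa using norm_le_exp_norm y⟩

/-- A function bounded by a multiple of `‖y‖` times a function of exponential growth has exponential growth. -/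
lemma ExpGrowth.of_norm_le {E' : Type} [NormedAddCommGroup E'] {F : Rd d → E} {G : Rd d → E'}
    (hG : ExpGrowth G) (hF : StronglyMeasurable F) (c : ℝ) (hc : 0 ≤ c)
    (h : ∀ y, ‖F y‖ ≤ c * (‖y‖ * ‖G y‖)) : ExpGrowth F := by
  obtain ⟨-, A, B, hA, hB, hAB⟩ := hG
  refine ⟨hF, c * A, B + 1, by positivity, by positivity, fun y => (h y).trans ?_⟩
  have h1 := norm_le_exp_norm y
  have : Real.exp ((B + 1) * ‖y‖) = Real.exp (B * ‖y‖) * Real.exp ‖y‖ := by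
    rw [← Real.exp_add]; ring_nf
  rw [this]
  calc c * (‖y‖ * ‖G y‖) ≤ c * (Real.exp ‖y‖ * (A * Real.exp (B * ‖y‖))) := by
        gcongr; exact hAB y
    _ = _ := by ring

lemma expGrowth_inner_left (v : Rd d) : ExpGrowth (fun y : Rd d => (⟪v, y⟫ : ℝ)) :=
  (expGrowth_const (1 : ℝ)).of_norm_le (by fun_prop) ‖v‖ (norm_nonneg _) fun y => by
    simpa using norm_inner_le_norm (𝕜 := ℝ) v y

lemma expGrowth_innerSL : ExpGrowth (fun y : Rd d => (innerSL ℝ y : Rd d →L[ℝ] ℝ)) :=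
  (expGrowth_const (1 : ℝ)).of_norm_le
    (innerSL ℝ (E := Rd d)).continuous.stronglyMeasurable 1 zero_le_one fun y => by
    simp [innerSL_apply_norm]

variable [NormedSpace ℝ E]

lemma ExpGrowth.smulRight {F : Rd d → E} (hF : ExpGrowth F) :
    ExpGrowth (fun y : Rd d => (innerSL ℝ y : Rd d →L[ℝ] ℝ).smulRight (F y)) := by
  refine hF.of_norm_le ?_ 1 zero_le_one fun y => by simp [innerSL_apply_norm]
  have hc : Continuous fun p : (Rd d →L[ℝ] ℝ) × E => p.1.smulRight p.2 :=
    isBoundedBilinearMap_smulRight.continuous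
  exact hc.comp_stronglyMeasurable
    ((innerSL ℝ (E := Rd d)).continuous.stronglyMeasurable.prodMk hF.1)

end Growth

namespace Admissible

variable {ν : Measure (Rd d)} {ψ : Rd d → ℝ} {E : Type} [NormedAddCommGroup E] [NormedSpace ℝ E]

lemma measurable_exponent (hψ : Admissible ν ψ) (x : Rd d) :
    Measurable (fun y : Rd d => ψ y + ⟪x, y⟫) :=
  hψ.measurable.add (by fun_prop)

/-- The exponential weights are dominated, uniformly for `x` in a ball, by an exponential of the
norm. -/
lemma exists_weight_le (hψ : Admissible ν ψ) :
    ∃ C K : ℝ, 0 ≤ C ∧ 0 ≤ K ∧ ∀ᵐ y ∂ν, ∀ R x, ‖x‖ ≤ R →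
      Real.exp (ψ y + ⟪x, y⟫) ≤ Real.exp C * Real.exp ((K + R) * ‖y‖) := by
  obtain ⟨C, K, hC, hK, h⟩ := hψ.growth
  refine ⟨C, K, hC, hK, h.mono fun y hy R x hx => ?_⟩
  rw [← Real.exp_add, Real.exp_le_exp]
  have h1 : ⟪x, y⟫ ≤ R * ‖y‖ := (real_inner_le_norm x y).trans (by gcongr)
  linarith

lemma integrable_weight_smul (hψ : Admissible ν ψ) {F : Rd d → E} (hF : ExpGrowth F) (x : Rd d) :
    Integrable (fun y => Real.exp (ψ y + ⟪x, y⟫) • F y) ν := by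
  obtain ⟨C, K, hC, hK, h⟩ := hψ.exists_weight_le
  obtain ⟨hm, A, B, hA, hB, hAB⟩ := hF
  refine Integrable.mono' ((hψ.expMoments (K + ‖x‖ + B) (by positivity)).const_mul
    (Real.exp C * A)) ?_ (h.mono fun y hy => ?_)
  · exact (((hψ.measurable_exponent x).exp).stronglyMeasurable.smul hm).aestronglyMeasurable
  · rw [norm_smul, Real.norm_of_nonneg (Real.exp_pos _).le]
    calc _ ≤ (Real.exp C * Real.exp ((K + ‖x‖) * ‖y‖)) * (A * Real.exp (B * ‖y‖)) := by
          gcongr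
          · exact hy _ x le_rfl
          · exact hAB y
      _ = _ := by
          rw [show (K + ‖x‖ + B) * ‖y‖ = (K + ‖x‖) * ‖y‖ + B * ‖y‖ by ring, Real.exp_add]; ring

lemma integrable_weight (hψ : Admissible ν ψ) (x : Rd d) :
    Integrable (fun y => Real.exp (ψ y + ⟪x, y⟫)) ν := by
  simpa using hψ.integrable_weight_smul (expGrowth_const (1 : ℝ)) x

lemma integral_weight_pos (hψ : Admissible ν ψ) (x : Rd d) :
    0 < ∫ y, Real.exp (ψ y + ⟪x, y⟫) ∂ν := by
  have := hψ.prob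
  exact integral_exp_pos (hψ.integrable_weight x)

lemma exp_logZ (hψ : Admissible ν ψ) (x : Rd d) :
    Real.exp (logZ ν ψ x) = ∫ y, Real.exp (ψ y + ⟪x, y⟫) ∂ν :=
  Real.exp_log (hψ.integral_weight_pos x)

lemma lintegral_weight (hψ : Admissible ν ψ) (x : Rd d) :
    ∫⁻ y, ENNReal.ofReal (Real.exp (ψ y + ⟪x, y⟫)) ∂ν = ENNReal.ofReal (Real.exp (logZ ν ψ x)) := by
  rw [hψ.exp_logZ, ofReal_integral_eq_lintegral_ofReal (hψ.integrable_weight x)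
    (Filter.Eventually.of_forall fun y => (Real.exp_pos _).le)]

lemma logPartition_eq (hψ : Admissible ν ψ) (x : Rd d) :
    logPartition ν ψ x = (logZ ν ψ x : EReal) := by
  rw [logPartition, hψ.lintegral_weight, ENNReal.log_ofReal_of_pos (Real.exp_pos _), Real.log_exp]

lemma extPotential_eq (hψ : Admissible ν ψ) (x : Rd d) :
    extPotential ν ψ x = ((-logZ ν ψ x : ℝ) : EReal) := by
  rw [extPotential, hψ.logPartition_eq]; rfl

lemma isProbabilityMeasure_gibbs (hψ : Admissible ν ψ) (x : Rd d) :
    IsProbabilityMeasure (gibbs ν ψ x) := by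
  have := hψ.prob
  exact isProbabilityMeasure_tilted (hψ.integrable_weight x)

lemma integrable_gibbs (hψ : Admissible ν ψ) {F : Rd d → E} (hF : ExpGrowth F) (x : Rd d) :
    Integrable F (gibbs ν ψ x) :=
  (integrable_tilted_iff (hψ.integrable_weight x) F).2 (hψ.integrable_weight_smul hF x)

lemma memLp_two_gibbs (hψ : Admissible ν ψ) {F : Rd d → ℝ} (hF : ExpGrowth F) (x : Rd d) :
    MemLp F 2 (gibbs ν ψ x) := by
  rw [memLp_two_iff_integrable_sq hF.1.aestronglyMeasurable]
  refine hψ.integrable_gibbs ?_ x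
  obtain ⟨hm, A, B, hA, hB, hAB⟩ := hF
  refine ⟨hm.pow 2, A ^ 2, B + B, by positivity, by positivity, fun y => ?_⟩
  rw [norm_pow, add_mul, Real.exp_add, show A ^ 2 * (Real.exp (B * ‖y‖) * Real.exp (B * ‖y‖)) =
    (A * Real.exp (B * ‖y‖)) ^ 2 by ring]
  gcongr
  exact hAB y

lemma memLp_id_gibbs (hψ : Admissible ν ψ) (x : Rd d) :
    MemLp (fun y : Rd d => y) 2 (gibbs ν ψ x) := by
  refine (memLp_norm_iff stronglyMeasurable_id.aestronglyMeasurable).1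
    (hψ.memLp_two_gibbs (F := fun y => ‖y‖) ?_ x)
  exact (expGrowth_const (1 : ℝ)).of_norm_le (by fun_prop) 1 zero_le_one fun y => by simp

lemma integral_gibbs (hψ : Admissible ν ψ) (F : Rd d → E) (x : Rd d) :
    ∫ y, F y ∂(gibbs ν ψ x) =
      Real.exp (-logZ ν ψ x) • ∫ y, Real.exp (ψ y + ⟪x, y⟫) • F y ∂ν := by
  rw [gibbs, integral_tilted, Real.exp_neg, hψ.exp_logZ, ← integral_smul]
  congr 1 with y
  rw [smul_smul]; congr 1; rw [div_eq_mul_inv, mul_comm]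

/-- Differentiation under the integral sign of a weighted Laplace transform. -/
lemma hasFDerivAt_laplace (hψ : Admissible ν ψ) {F : Rd d → E} (hF : ExpGrowth F) (x : Rd d) :
    HasFDerivAt (fun x => ∫ y, Real.exp (ψ y + ⟪x, y⟫) • F y ∂ν)
      (∫ y, Real.exp (ψ y + ⟪x, y⟫) • (innerSL ℝ y : Rd d →L[ℝ] ℝ).smulRight (F y) ∂ν) x := by
  obtain ⟨C, K, hC, hK, h⟩ := hψ.exists_weight_le
  obtain ⟨hm, A, B, hA, hB, hAB⟩ := hF.smulRight
  refine hasFDerivAt_integral_of_dominated_of_fderiv_le (s := Metric.ball x 1)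
    (F' := fun x y => Real.exp (ψ y + ⟪x, y⟫) • (innerSL ℝ y : Rd d →L[ℝ] ℝ).smulRight (F y))
    (bound := fun y => Real.exp C * A * Real.exp ((K + (‖x‖ + 1) + B) * ‖y‖))
    (Metric.ball_mem_nhds x one_pos)
    (Filter.Eventually.of_forall fun z => (hψ.integrable_weight_smul hF z).1)
    (hψ.integrable_weight_smul hF x) (hψ.integrable_weight_smul hF.smulRight x).1
    (h.mono fun y hy z hz => ?_)
    ((hψ.expMoments (K + (‖x‖ + 1) + B) (by positivity)).const_mul _)
    (Filter.Eventually.of_forall fun y z _ => ?_)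
  · have hz' : ‖z‖ ≤ ‖x‖ + 1 := by
      have := norm_le_norm_add_norm_sub' z x
      rw [Metric.mem_ball, dist_eq_norm] at hz
      linarith
    rw [norm_smul, Real.norm_of_nonneg (Real.exp_pos _).le]
    calc _ ≤ (Real.exp C * Real.exp ((K + (‖x‖ + 1)) * ‖y‖)) * (A * Real.exp (B * ‖y‖)) := by
          gcongr
          · exact hy _ z hz'
          · exact hAB y
      _ = _ := by rw [add_mul _ B, Real.exp_add]; ring
  · have h1 : HasFDerivAt (fun z : Rd d => ψ y + ⟪z, y⟫) (innerSL ℝ y : Rd d →L[ℝ] ℝ) z := by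
      have h2 : (fun z : Rd d => ψ y + ⟪z, y⟫) = fun z => ψ y + (innerSL ℝ y : Rd d →L[ℝ] ℝ) z := by
        ext z; simp [real_inner_comm]
      rw [h2]
      exact ((innerSL ℝ y : Rd d →L[ℝ] ℝ).hasFDerivAt).const_add _
    have h3 := (h1.exp).smul_const (F y)
    convert! h3 using 1
    ext v
    simp [smul_smul]

/-- Smoothness by induction on the order: the derivative of a weighted Laplace transform is again a
weighted Laplace transform, with values in a larger space. -/
lemma contDiff_laplace (hψ : Admissible ν ψ) {F : Rd d → E} (hF : ExpGrowth F) :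
    ContDiff ℝ ∞ (fun x => ∫ y, Real.exp (ψ y + ⟪x, y⟫) • F y ∂ν) := by
  rw [contDiff_infty]
  intro n
  induction n generalizing E with
  | zero =>
    rw [Nat.cast_zero, contDiff_zero]
    exact continuous_iff_continuousAt.2 fun x => (hψ.hasFDerivAt_laplace hF x).continuousAt
  | succ n ih =>
    rw [Nat.cast_succ, contDiff_succ_iff_hasFDerivAt]
    exact ⟨_, ih hF.smulRight, fun x => hψ.hasFDerivAt_laplace hF x⟩

lemma contDiff_logZ (hψ : Admissible ν ψ) : ContDiff ℝ ∞ (logZ ν ψ) := by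
  have h := hψ.contDiff_laplace (expGrowth_const (1 : ℝ))
  simp only [smul_eq_mul, mul_one] at h
  exact h.log fun x => (hψ.integral_weight_pos x).ne'

lemma contDiff_baryMap (hψ : Admissible ν ψ) : ContDiff ℝ ∞ (baryMap ν ψ) := by
  have h : baryMap ν ψ = fun x => Real.exp (-logZ ν ψ x) •
      ∫ y, Real.exp (ψ y + ⟪x, y⟫) • y ∂ν := funext fun x => hψ.integral_gibbs _ x
  rw [h]
  exact (hψ.contDiff_logZ.neg.exp).smul (hψ.contDiff_laplace expGrowth_id)

lemma hasFDerivAt_logZ (hψ : Admissible ν ψ) (x : Rd d) :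
    HasFDerivAt (logZ ν ψ) (∫ y, (innerSL ℝ y : Rd d →L[ℝ] ℝ) ∂(gibbs ν ψ x)) x := by
  have h := hψ.hasFDerivAt_laplace (expGrowth_const (1 : ℝ)) x
  simp only [smul_eq_mul, mul_one] at h
  have h1 := h.log (hψ.integral_weight_pos x).ne'
  convert! h1 using 1
  rw [hψ.integral_gibbs, Real.exp_neg, hψ.exp_logZ]
  congr 2 with y
  simp

/-- The derivative of a mean over the exponential family is a covariance. -/
lemma hasFDerivAt_integral_gibbs (hψ : Admissible ν ψ) {F : Rd d → E} (hF : ExpGrowth F)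
    (x : Rd d) :
    HasFDerivAt (fun x => ∫ y, F y ∂(gibbs ν ψ x))
      (∫ y, (innerSL ℝ y : Rd d →L[ℝ] ℝ).smulRight (F y) ∂(gibbs ν ψ x) -
        (∫ y, (innerSL ℝ y : Rd d →L[ℝ] ℝ) ∂(gibbs ν ψ x)).smulRight (∫ y, F y ∂(gibbs ν ψ x)))
      x := by
  simp_rw [hψ.integral_gibbs F]
  have h := ((hψ.hasFDerivAt_logZ x).neg.exp).smul (hψ.hasFDerivAt_laplace hF x)
  convert! h using 1
  rw [hψ.integral_gibbs (fun y => (innerSL ℝ y : Rd d →L[ℝ] ℝ).smulRight (F y)), sub_eq_add_neg]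
  congr 1
  ext v
  simp [smul_smul, mul_comm]

lemma integral_innerSL_gibbs_apply (hψ : Admissible ν ψ) (x v : Rd d) :
    (∫ y, (innerSL ℝ y : Rd d →L[ℝ] ℝ) ∂(gibbs ν ψ x)) v = ⟪baryMap ν ψ x, v⟫ := by
  rw [ContinuousLinearMap.integral_apply (hψ.integrable_gibbs expGrowth_innerSL x), baryMap,
    real_inner_comm, ← integral_inner (hψ.integrable_gibbs expGrowth_id x)]
  simp [real_inner_comm]

lemma hasGradientAt_logZ (hψ : Admissible ν ψ) (x : Rd d) :
    HasGradientAt (logZ ν ψ) (baryMap ν ψ x) x := by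
  rw [hasGradientAt_iff_hasFDerivAt]
  convert! hψ.hasFDerivAt_logZ x using 1
  ext v
  rw [hψ.integral_innerSL_gibbs_apply]
  simp

lemma iteratedFDeriv_two_logZ (hψ : Admissible ν ψ) (x u v : Rd d) :
    iteratedFDeriv ℝ 2 (logZ ν ψ) x ![u, v] =
      cov[fun y => ⟪u, y⟫, fun y => ⟪v, y⟫; gibbs ν ψ x] := by
  have := hψ.isProbabilityMeasure_gibbs x
  have h1 : fderiv ℝ (logZ ν ψ) = fun x => ∫ y, (innerSL ℝ y : Rd d →L[ℝ] ℝ) ∂(gibbs ν ψ x) :=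
    funext fun x => (hψ.hasFDerivAt_logZ x).fderiv
  rw [iteratedFDeriv_two_apply, h1, (hψ.hasFDerivAt_integral_gibbs expGrowth_innerSL x).fderiv,
    covariance_eq_sub (hψ.memLp_two_gibbs (expGrowth_inner_left u) x)
      (hψ.memLp_two_gibbs (expGrowth_inner_left v) x)]
  simp only [Matrix.cons_val_zero, Matrix.cons_val_one, sub_apply,
    ContinuousLinearMap.smulRight_apply, smul_apply, smul_eq_mul]
  congr 1
  · have h2 := hψ.integrable_gibbs expGrowth_innerSL.smulRight x
    rw [ContinuousLinearMap.integral_apply h2, ContinuousLinearMap.integral_apply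
      (h2.apply_continuousLinearMap u)]
    simp [real_inner_comm]
  · have h2 := hψ.integrable_gibbs (E := Rd d →L[ℝ] ℝ) expGrowth_innerSL x
    rw [ContinuousLinearMap.integral_apply h2, ContinuousLinearMap.integral_apply h2]
    simp [real_inner_comm]

lemma integral_inner_gibbs (hψ : Admissible ν ψ) (x v : Rd d) :
    ∫ y, ⟪v, y⟫ ∂(gibbs ν ψ x) = ⟪v, baryMap ν ψ x⟫ :=
  integral_inner (hψ.integrable_gibbs expGrowth_id x) v

/-- The strict gradient inequality for the log-partition function. It integrates `1 + s < exp s`,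
where `s y = ⟪a - x, y - T x⟫` is not almost surely zero since `ν` charges no hyperplane fully. -/
lemma logZ_add_inner_lt (hψ : Admissible ν ψ) (hν : NotOnHyperplane ν) {a x : Rd d} (hax : a ≠ x) :
    logZ ν ψ x + ⟪a - x, baryMap ν ψ x⟫ < logZ ν ψ a := by
  have := hψ.prob
  have := hψ.isProbabilityMeasure_gibbs x
  set c : ℝ := ⟪a - x, baryMap ν ψ x⟫ with hc
  have hi1 : Integrable (fun y => ⟪a - x, y⟫) (gibbs ν ψ x) :=
    hψ.integrable_gibbs (expGrowth_inner_left _) x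
  have hg : Integrable (fun y => Real.exp ⟪a - x, y⟫) (gibbs ν ψ x) := by
    refine hψ.integrable_gibbs ⟨by fun_prop, 1, ‖a - x‖, zero_le_one, norm_nonneg _, fun y => ?_⟩ x
    rw [Real.norm_of_nonneg (Real.exp_pos _).le, one_mul]
    gcongr
    exact real_inner_le_norm _ _
  have hexp : ∫ y, Real.exp ⟪a - x, y⟫ ∂(gibbs ν ψ x) = Real.exp (logZ ν ψ a - logZ ν ψ x) := by
    rw [gibbs, integral_exp_tilted, Real.exp_sub, hψ.exp_logZ, hψ.exp_logZ]
    congr 2 with y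
    simp only [Pi.add_apply, inner_sub_left]
    congr 1; ring
  have hi3 : Integrable (fun y => ⟪a - x, y⟫ - c) (gibbs ν ψ x) := hi1.sub (integrable_const _)
  have hi2 : Integrable (fun y => 1 + (⟪a - x, y⟫ - c)) (gibbs ν ψ x) :=
    (integrable_const _).add hi3
  have hint : Integrable (fun y => Real.exp (-c) * Real.exp ⟪a - x, y⟫ - (1 + (⟪a - x, y⟫ - c)))
      (gibbs ν ψ x) :=
    (hg.const_mul _).sub hi2
  have hval : ∫ y, (Real.exp (-c) * Real.exp ⟪a - x, y⟫ - (1 + (⟪a - x, y⟫ - c))) ∂(gibbs ν ψ x) =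
      Real.exp (logZ ν ψ a - logZ ν ψ x - c) - 1 := by
    rw [integral_sub (hg.const_mul _) hi2,
      integral_add (integrable_const _) hi3,
      integral_sub hi1 (integrable_const _), integral_const_mul, hexp, hψ.integral_inner_gibbs]
    simp only [integral_const, probReal_univ, smul_eq_mul, one_mul]
    rw [← hc, ← Real.exp_add]
    ring_nf
  have hnn : ∀ y, 0 ≤ Real.exp (-c) * Real.exp ⟪a - x, y⟫ - (1 + (⟪a - x, y⟫ - c)) := fun y => by
    rw [← Real.exp_add]
    linarith [Real.add_one_le_exp (-c + ⟪a - x, y⟫)]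
  have hpos : 0 < Real.exp (logZ ν ψ a - logZ ν ψ x - c) - 1 := by
    rw [← hval]
    refine lt_of_le_of_ne (integral_nonneg hnn) fun h0 => ?_
    have h1 := (integral_eq_zero_iff_of_nonneg hnn hint).1 h0.symm
    have h2 := (absolutelyContinuous_tilted (hψ.integrable_weight x)).ae_eq h1
    refine hν (a - x) c (sub_ne_zero.2 hax) (h2.mono fun y hy => ?_)
    by_contra hne
    have h3 := Real.add_one_lt_exp (x := -c + ⟪a - x, y⟫) (fun h => hne (by linarith))
    rw [Real.exp_add] at h3
    simp only [Pi.zero_apply] at hy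
    linarith
  have : 0 < logZ ν ψ a - logZ ν ψ x - c := by
    by_contra hle
    have := Real.exp_le_one_iff.2 (not_lt.1 hle)
    linarith
  linarith

lemma logZ_add_inner_le (hψ : Admissible ν ψ) (hν : NotOnHyperplane ν) (a x : Rd d) :
    logZ ν ψ x + ⟪a - x, baryMap ν ψ x⟫ ≤ logZ ν ψ a := by
  rcases eq_or_ne a x with rfl | h
  · simp
  · exact (hψ.logZ_add_inner_lt hν h).le

lemma strictConvexOn_logZ (hψ : Admissible ν ψ) (hν : NotOnHyperplane ν) :
    StrictConvexOn ℝ univ (logZ ν ψ) := by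
  refine ⟨convex_univ, fun a _ b _ hab s t hs ht hst => ?_⟩
  -- The gradient inequality at `z`, applied to both end points, whose linear terms cancel.
  set z := s • a + t • b with hz
  have e1 : a - z = t • (a - b) := by
    rw [hz, ← eq_sub_iff_add_eq] at *
    subst hst
    module
  have e2 : b - z = -(s • (a - b)) := by
    rw [hz, ← eq_sub_iff_add_eq'] at *
    subst hst
    module
  have ha : a ≠ z := by
    rw [← sub_ne_zero, e1]; exact smul_ne_zero ht.ne' (sub_ne_zero.2 hab)
  have h1 := hψ.logZ_add_inner_lt hν ha
  have h2 := hψ.logZ_add_inner_le hν b z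
  rw [e1, inner_smul_left] at h1
  rw [e2, inner_neg_left, inner_smul_left] at h2
  simp only [RCLike.conj_to_real, smul_eq_mul] at h1 h2 ⊢
  have h3 := mul_lt_mul_of_pos_left h1 hs
  have h4 := mul_le_mul_of_nonneg_left h2 ht.le
  have h5 : s * logZ ν ψ z + t * logZ ν ψ z = logZ ν ψ z := by rw [← add_mul, hst, one_mul]
  nlinarith

lemma injective_baryMap (hψ : Admissible ν ψ) (hν : NotOnHyperplane ν) :
    Function.Injective (baryMap ν ψ) := by
  intro a x h
  by_contra hne
  have h1 := hψ.logZ_add_inner_lt hν hne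
  have h2 := hψ.logZ_add_inner_lt hν (Ne.symm hne)
  rw [h, ← neg_sub, inner_neg_left] at h2
  linarith

/-- By the Lusin–Souslin theorem the barycentric map has a measurable image and a measurable inverse on
it. -/
lemma measurableEmbedding_baryMap (hψ : Admissible ν ψ) (hν : NotOnHyperplane ν) :
    MeasurableEmbedding (baryMap ν ψ) :=
  hψ.contDiff_baryMap.continuous.measurableEmbedding (hψ.injective_baryMap hν)

end Admissible

/-! ### Relative entropy with respect to an exponentially tilted measure -/

section Entropy

variable {α : Type*} [MeasurableSpace α] {P Q : Measure α} [IsProbabilityMeasure P] {g : α → ℝ}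

/-- A tilting exponent is integrable under the tilted measure as soon as it is bounded above by an
integrable function: its negative part is integrable because `exp s * (-s) ≤ 1`. -/
lemma integrable_tilted_of_le (hg : Measurable g) (hexp : Integrable (fun a => Real.exp (g a)) P)
    {b : α → ℝ} (hb : Integrable b (P.tilted g)) (hle : ∀ᵐ a ∂(P.tilted g), g a ≤ b a) :
    Integrable g (P.tilted g) := by
  have hneg : Integrable (fun a => max (-g a) 0) (P.tilted g) := by
    rw [integrable_tilted_iff hexp]
    refine Integrable.mono' (integrable_const (1 : ℝ)) (by fun_prop)
      (Filter.Eventually.of_forall fun a => ?_)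
    rw [smul_eq_mul, Real.norm_of_nonneg (by positivity)]
    rcases le_total (-g a) 0 with h | h
    · simp [max_eq_right h]
    · rw [max_eq_left h]
      calc Real.exp (g a) * -g a ≤ Real.exp (g a) * Real.exp (-g a) := by
            gcongr; linarith [Real.add_one_le_exp (-g a)]
        _ = 1 := by rw [← Real.exp_add]; simp
  refine Integrable.mono' (hb.norm.add hneg) hg.aestronglyMeasurable (hle.mono fun a ha => ?_)
  simp only [Pi.add_apply, Real.norm_eq_abs]
  rcases le_total (g a) 0 with h | h
  · rw [abs_of_nonpos h]; linarith [le_max_left (-g a) 0, abs_nonneg (b a)]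
  · rw [abs_of_nonneg h]; linarith [le_max_right (-g a) 0, le_abs_self (b a)]

/-- The chain rule for the relative entropy under a normalized tilting of the reference measure. -/
lemma toReal_klDiv_eq_add_integral [IsProbabilityMeasure Q]
    (hexp : Integrable (fun a => Real.exp (g a)) P) (h1 : ∫ a, Real.exp (g a) ∂P = 1)
    (hgQ : Integrable g Q) (hfin : klDiv Q P ≠ ⊤) :
    klDiv Q (P.tilted g) ≠ ⊤ ∧
      (klDiv Q P).toReal = (klDiv Q (P.tilted g)).toReal + ∫ a, g a ∂Q := by
  have := isProbabilityMeasure_tilted hexp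
  obtain ⟨hac, hint⟩ := klDiv_ne_top_iff.1 hfin
  have hac' : Q ≪ P.tilted g := hac.trans (absolutelyContinuous_tilted hexp)
  have hint' := integrable_llr_tilted_right hac hgQ hint hexp
  refine ⟨klDiv_ne_top hac' hint', ?_⟩
  rw [toReal_klDiv_of_measure_eq hac (by simp), toReal_klDiv_of_measure_eq hac' (by simp),
    integral_llr_tilted_right hac hgQ hexp hint, h1]
  simp

/-- The Gibbs variational inequality. -/
lemma integral_le_klDiv [IsProbabilityMeasure Q]
    (hexp : Integrable (fun a => Real.exp (g a)) P) (h1 : ∫ a, Real.exp (g a) ∂P = 1)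
    (hgQ : Integrable g Q) : ((∫ a, g a ∂Q : ℝ) : EReal) ≤ (klDiv Q P : EReal) := by
  by_cases hfin : klDiv Q P = ⊤
  · simp [hfin]
  · obtain ⟨-, h⟩ := toReal_klDiv_eq_add_integral hexp h1 hgQ hfin
    rw [← EReal.coe_ennreal_toReal hfin, EReal.coe_le_coe_iff, h]
    linarith [ENNReal.toReal_nonneg (a := klDiv Q (P.tilted g))]

lemma klDiv_tilted_self (hexp : Integrable (fun a => Real.exp (g a)) P)
    (h1 : ∫ a, Real.exp (g a) ∂P = 1) (hgQ : Integrable g (P.tilted g)) :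
    (klDiv (P.tilted g) P : EReal) = ((∫ a, g a ∂(P.tilted g) : ℝ) : EReal) := by
  have := isProbabilityMeasure_tilted hexp
  have hac := tilted_absolutelyContinuous P g
  have hllr : llr (P.tilted g) P =ᵐ[P.tilted g] g := by
    refine hac.ae_eq ?_
    filter_upwards [log_rnDeriv_tilted_left_self hexp] with a ha
    rw [llr, ha, h1]; simp
  have hint := hgQ.congr hllr.symm
  rw [← EReal.coe_ennreal_toReal (klDiv_ne_top hac hint),
    toReal_klDiv_of_measure_eq hac (by simp), integral_congr_ae hllr]

end Entropy

/-! ### Couplings of measures with finite second moments -/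

section Coupling

variable {η ν : Measure (Rd d)} {π : Measure (Rd d × Rd d)}
  {E : Type*} [NormedAddCommGroup E]

lemma IsCoupling.isProbabilityMeasure [IsProbabilityMeasure η] (h : IsCoupling η ν π) :
    IsProbabilityMeasure π := by
  have h1 : IsProbabilityMeasure (π.map Prod.fst) := by
    have := h.1; rw [Measure.fst] at this; rw [this]; infer_instance
  exact Measure.isProbabilityMeasure_of_map Prod.fst

lemma IsCoupling.measurePreserving_fst (h : IsCoupling η ν π) :
    MeasurePreserving (Prod.fst : Rd d × Rd d → Rd d) π η := ⟨measurable_fst, h.1⟩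

lemma IsCoupling.measurePreserving_snd (h : IsCoupling η ν π) :
    MeasurePreserving (Prod.snd : Rd d × Rd d → Rd d) π ν := ⟨measurable_snd, h.2⟩

lemma IsP2.integrable_norm (hη : IsP2 η) : Integrable (fun x : Rd d => ‖x‖) η := by
  have := hη.1
  exact (hη.2.integrable one_le_two).norm

lemma IsCoupling.integrable_comp_fst (h : IsCoupling η ν π) {f : Rd d → E} (hf : Integrable f η) :
    Integrable (fun p => f p.1) π :=
  h.measurePreserving_fst.integrable_comp_of_integrable hf

lemma IsCoupling.integrable_comp_snd (h : IsCoupling η ν π) {f : Rd d → E} (hf : Integrable f ν) :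
    Integrable (fun p => f p.2) π :=
  h.measurePreserving_snd.integrable_comp_of_integrable hf

variable [NormedSpace ℝ E]

lemma IsCoupling.integral_comp_fst (h : IsCoupling η ν π) {f : Rd d → E} (hf : Integrable f η) :
    ∫ p, f p.1 ∂π = ∫ x, f x ∂η := by
  have hm := h.measurePreserving_fst
  rw [← hm.map_eq, integral_map hm.aemeasurable (by rw [hm.map_eq]; exact hf.1)]

lemma IsCoupling.integral_comp_snd (h : IsCoupling η ν π) {f : Rd d → E} (hf : Integrable f ν) :
    ∫ p, f p.2 ∂π = ∫ x, f x ∂ν := by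
  have hm := h.measurePreserving_snd
  rw [← hm.map_eq, integral_map hm.aemeasurable (by rw [hm.map_eq]; exact hf.1)]

/-- The inner product of two square-integrable vector-valued functions is integrable. -/
lemma integrable_inner_of_memLp {α : Type*} [MeasurableSpace α] {P : Measure α} {f g : α → Rd d}
    (hf : MemLp f 2 P) (hg : MemLp g 2 P) : Integrable (fun a => ⟪f a, g a⟫) P := by
  refine Integrable.mono' (hf.norm.integrable_mul hg.norm) (hf.1.inner hg.1)
    (Filter.Eventually.of_forall fun a => ?_)
  exact norm_inner_le_norm (𝕜 := ℝ) _ _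

lemma IsCoupling.memLp_fst (h : IsCoupling η ν π) (hη : IsP2 η) :
    MemLp (fun p : Rd d × Rd d => p.1) 2 π :=
  hη.2.comp_measurePreserving h.measurePreserving_fst

lemma IsCoupling.memLp_snd (h : IsCoupling η ν π) (hν : IsP2 ν) :
    MemLp (fun p : Rd d × Rd d => p.2) 2 π :=
  hν.2.comp_measurePreserving h.measurePreserving_snd

lemma IsCoupling.integrable_inner (h : IsCoupling η ν π) (hη : IsP2 η) (hν : IsP2 ν) :
    Integrable (fun p : Rd d × Rd d => ⟪p.1, p.2⟫) π :=
  integrable_inner_of_memLp (h.memLp_fst hη) (h.memLp_snd hν)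

end Coupling

/-! ### The Gibbs kernel -/

namespace Admissible

variable {ν : Measure (Rd d)} {ψ : Rd d → ℝ}

lemma measurable_logZ (hψ : Admissible ν ψ) : Measurable (logZ ν ψ) :=
  hψ.contDiff_logZ.continuous.measurable

lemma measurable_baryMap (hψ : Admissible ν ψ) : Measurable (baryMap ν ψ) :=
  hψ.contDiff_baryMap.continuous.measurable

end Admissible

/-- The logarithm of the density of `gibbs ν ψ p.1` with respect to `ν`, at `p.2`. -/
noncomputable def gibbsExponent (ν : Measure (Rd d)) (ψ : Rd d → ℝ) (p : Rd d × Rd d) : ℝ :=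
  ψ p.2 + ⟪p.1, p.2⟫ - logZ ν ψ p.1

namespace Admissible

variable {ν : Measure (Rd d)} {ψ : Rd d → ℝ}

lemma measurable_gibbsExponent (hψ : Admissible ν ψ) : Measurable (gibbsExponent ν ψ) :=
  ((hψ.measurable.comp measurable_snd).add (by fun_prop)).sub
    (hψ.measurable_logZ.comp measurable_fst)

lemma gibbs_apply (hψ : Admissible ν ψ) (x : Rd d) {s : Set (Rd d)} (hs : MeasurableSet s) :
    gibbs ν ψ x s = ∫⁻ y in s, ENNReal.ofReal (Real.exp (gibbsExponent ν ψ (x, y))) ∂ν := by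
  rw [gibbs, tilted_apply' _ _ hs]
  congr 1 with y
  rw [← hψ.exp_logZ, ← Real.exp_sub, gibbsExponent]

lemma measurable_gibbs (hψ : Admissible ν ψ) : Measurable (gibbs ν ψ) := by
  have := hψ.prob
  refine Measure.measurable_of_measurable_coe _ fun s hs => ?_
  simp_rw [hψ.gibbs_apply _ hs]
  exact (hψ.measurable_gibbsExponent.exp.ennreal_ofReal).lintegral_prod_right'

/-- The Gibbs measures, as a Markov kernel precomposed with a measurable map. -/
noncomputable def kernel (hψ : Admissible ν ψ) {h : Rd d → Rd d} (hh : Measurable h) :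
    Kernel (Rd d) (Rd d) where
  toFun x := gibbs ν ψ (h x)
  measurable' := hψ.measurable_gibbs.comp hh

lemma kernel_apply (hψ : Admissible ν ψ) {h : Rd d → Rd d} (hh : Measurable h) (x : Rd d) :
    hψ.kernel hh x = gibbs ν ψ (h x) := rfl

instance (hψ : Admissible ν ψ) {h : Rd d → Rd d} (hh : Measurable h) :
    IsMarkovKernel (hψ.kernel hh) :=
  ⟨fun x => hψ.isProbabilityMeasure_gibbs (h x)⟩

section Plan

variable {η : Measure (Rd d)} [IsProbabilityMeasure η] {h : Rd d → Rd d}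

lemma measurable_exponent_comp (hψ : Admissible ν ψ) (hh : Measurable h) :
    Measurable (fun p : Rd d × Rd d => gibbsExponent ν ψ (h p.1, p.2)) :=
  hψ.measurable_gibbsExponent.comp (by fun_prop)

/-- The Gibbs density is normalized with respect to `η ⊗ ν`, whatever the map `h` in its first
argument. -/
lemma lintegral_exp_exponent (hψ : Admissible ν ψ) (hh : Measurable h) :
    ∫⁻ p, ENNReal.ofReal (Real.exp (gibbsExponent ν ψ (h p.1, p.2))) ∂(η.prod ν) = 1 := by
  have := hψ.prob
  rw [lintegral_prod _ (hψ.measurable_exponent_comp hh).exp.ennreal_ofReal.aemeasurable]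
  have h1 : ∀ x, ∫⁻ y, ENNReal.ofReal (Real.exp (gibbsExponent ν ψ (h x, y))) ∂ν = 1 := fun x => by
    have := hψ.isProbabilityMeasure_gibbs (h x)
    rw [← setLIntegral_univ, ← hψ.gibbs_apply _ MeasurableSet.univ, measure_univ]
  simp [h1]

lemma integrable_exp_exponent (hψ : Admissible ν ψ) (hh : Measurable h) :
    Integrable (fun p => Real.exp (gibbsExponent ν ψ (h p.1, p.2))) (η.prod ν) := by
  refine ⟨(hψ.measurable_exponent_comp hh).exp.aestronglyMeasurable, ?_⟩
  rw [hasFiniteIntegral_iff_ofReal (Filter.Eventually.of_forall fun p => (Real.exp_pos _).le),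
    hψ.lintegral_exp_exponent hh]
  exact ENNReal.one_lt_top

lemma integral_exp_exponent (hψ : Admissible ν ψ) (hh : Measurable h) :
    ∫ p, Real.exp (gibbsExponent ν ψ (h p.1, p.2)) ∂(η.prod ν) = 1 := by
  rw [integral_eq_lintegral_of_nonneg_ae (Filter.Eventually.of_forall fun p => (Real.exp_pos _).le)
    (hψ.measurable_exponent_comp hh).exp.aestronglyMeasurable, hψ.lintegral_exp_exponent hh]
  simp

lemma tilted_eq_compProd (hψ : Admissible ν ψ) (hh : Measurable h) :
    (η.prod ν).tilted (fun p => gibbsExponent ν ψ (h p.1, p.2)) = η ⊗ₘ hψ.kernel hh := by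
  have := hψ.prob
  have hm := (hψ.measurable_exponent_comp hh).exp.ennreal_ofReal
  ext s hs
  rw [tilted_apply' _ _ hs, hψ.integral_exp_exponent hh, Measure.compProd_apply hs,
    ← lintegral_indicator hs]
  simp only [div_one]
  rw [lintegral_prod _ (hm.indicator hs).aemeasurable]
  congr 1 with x
  rw [kernel_apply, hψ.gibbs_apply _ (measurable_prodMk_left hs),
    ← lintegral_indicator (measurable_prodMk_left hs)]
  rfl

/-- The second equation of the Schrödinger system says that the second marginal of the Gibbs plan
is `ν`. -/
lemma isCoupling_compProd (hψ : Admissible ν ψ)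
    (hss2 : ∀ᵐ y ∂ν, ∫⁻ x, ENNReal.ofReal (Real.exp (gibbsExponent ν ψ (x, y))) ∂η = 1) :
    IsCoupling η ν (η ⊗ₘ hψ.kernel measurable_id) := by
  have := hψ.prob
  have hm := (hψ.measurable_exponent_comp measurable_id).exp.ennreal_ofReal
  refine ⟨Measure.fst_compProd _ _, ?_⟩
  ext s hs
  rw [Measure.snd_apply hs, ← hψ.tilted_eq_compProd, tilted_apply' _ _ (measurable_snd hs),
    hψ.integral_exp_exponent measurable_id, ← lintegral_indicator (measurable_snd hs)]
  simp only [div_one]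
  rw [lintegral_prod_symm _ (hm.indicator (measurable_snd hs)).aemeasurable]
  have h1 : ∀ᵐ y ∂ν, ∫⁻ x, (Prod.snd ⁻¹' s).indicator (fun p : Rd d × Rd d =>
      ENNReal.ofReal (Real.exp (gibbsExponent ν ψ (id p.1, p.2)))) (x, y) ∂η =
        s.indicator 1 y := by
    filter_upwards [hss2] with y hy
    by_cases hys : y ∈ s
    · simpa [indicator, hys] using hy
    · simp [indicator, hys]
  rw [lintegral_congr_ae h1, lintegral_indicator_one hs]

end Plan

end Admissible

/-! ### Schrödinger potentials -/

/-- One equation of a Schrödinger system bounds the other potential from above by a function of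
linear growth: it suffices to integrate over a set of positive mass on which the position is bounded
and the potential is bounded from below. -/
lemma exists_growth_of_lintegral_eq_one {η ρ : Measure (Rd d)} [IsProbabilityMeasure η]
    {φ ψ : Rd d → ℝ} (hφ : Measurable φ)
    (h : ∀ᵐ y ∂ρ, ∫⁻ x, ENNReal.ofReal (Real.exp (φ x + ψ y + ⟪x, y⟫)) ∂η = 1) :
    ∃ C K : ℝ, 0 ≤ C ∧ 0 ≤ K ∧ ∀ᵐ y ∂ρ, ψ y ≤ C + K * ‖y‖ := by
  let A : ℕ → Set (Rd d) := fun n => {x | ‖x‖ ≤ n ∧ -(n : ℝ) ≤ φ x}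
  have hA : ∀ n, MeasurableSet (A n) := fun n =>
    (measurableSet_le measurable_norm measurable_const).inter
      (measurableSet_le measurable_const hφ)
  have hU : (⋃ n, A n) = univ := by
    refine eq_univ_of_forall fun x => mem_iUnion.2 ?_
    obtain ⟨n, hn⟩ := exists_nat_ge (max ‖x‖ (-φ x))
    exact ⟨n, (le_max_left _ _).trans hn, by linarith [(le_max_right ‖x‖ (-φ x)).trans hn]⟩
  obtain ⟨n, hn⟩ : ∃ n, 0 < η (A n) := by
    by_contra! hc
    have : η (⋃ n, A n) = 0 := measure_iUnion_null fun n => le_antisymm (hc n) zero_le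
    rw [hU, measure_univ] at this
    exact one_ne_zero this
  set p := η.real (A n) with hp
  have hp0 : 0 < p := ENNReal.toReal_pos hn.ne' (measure_ne_top _ _)
  have hp1 : p ≤ 1 := measureReal_le_one
  refine ⟨n - Real.log p, n, ?_, n.cast_nonneg, h.mono fun y hy => ?_⟩
  · linarith [Real.log_nonpos hp0.le hp1, (n.cast_nonneg : (0 : ℝ) ≤ n)]
  · have h1 : ENNReal.ofReal (Real.exp (-n + ψ y - n * ‖y‖)) * η (A n) ≤ 1 := by
      rw [← hy, ← setLIntegral_const]
      refine (setLIntegral_mono' (hA n) fun x hx => ?_).trans (setLIntegral_le_lintegral _ _)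
      have h2 : -(n * ‖y‖) ≤ ⟪x, y⟫ := by
        have := (abs_le.1 (abs_real_inner_le_norm x y)).1
        have h3 : ‖x‖ * ‖y‖ ≤ n * ‖y‖ := by gcongr; exact hx.1
        linarith
      have := hx.2
      gcongr
      linarith
    have h2 : Real.exp (-n + ψ y - n * ‖y‖) * p ≤ 1 := by
      rw [← ofReal_measureReal (measure_ne_top _ _), ← ENNReal.ofReal_mul (Real.exp_pos _).le] at h1
      exact ENNReal.ofReal_le_one.1 h1
    rw [← Real.exp_log hp0, ← Real.exp_add, Real.exp_le_one_iff] at h2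
    linarith

namespace IsSchrodingerPotentials

variable {η ν : Measure (Rd d)} {φ ψ : Rd d → ℝ}

lemma admissible (hpot : IsSchrodingerPotentials η ν φ ψ) [IsProbabilityMeasure η]
    (hν : IsProbabilityMeasure ν) (hexp : HasExpMoments ν) : Admissible ν ψ :=
  ⟨hν, hexp, hpot.measurable_right,
    exists_growth_of_lintegral_eq_one hpot.measurable_left hpot.ss2⟩

lemma ae_eq_neg_logZ (hpot : IsSchrodingerPotentials η ν φ ψ) (hψ : Admissible ν ψ) :
    ∀ᵐ x ∂η, φ x = -logZ ν ψ x := by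
  filter_upwards [hpot.ss1] with x hx
  have h1 : ∀ y, ENNReal.ofReal (Real.exp (φ x + ψ y + ⟪x, y⟫)) =
      ENNReal.ofReal (Real.exp (φ x)) * ENNReal.ofReal (Real.exp (ψ y + ⟪x, y⟫)) := fun y => by
    rw [← ENNReal.ofReal_mul (Real.exp_pos _).le, ← Real.exp_add, add_assoc]
  simp_rw [h1] at hx
  rw [lintegral_const_mul _ (hψ.measurable_exponent x).exp.ennreal_ofReal, hψ.lintegral_weight,
    ← ENNReal.ofReal_mul (Real.exp_pos _).le, ← Real.exp_add, ENNReal.ofReal_eq_one,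
    Real.exp_eq_one_iff] at hx
  linarith

lemma lintegral_gibbsExponent (hpot : IsSchrodingerPotentials η ν φ ψ) (hψ : Admissible ν ψ) :
    ∀ᵐ y ∂ν, ∫⁻ x, ENNReal.ofReal (Real.exp (gibbsExponent ν ψ (x, y))) ∂η = 1 := by
  filter_upwards [hpot.ss2] with y hy
  rw [← hy]
  refine lintegral_congr_ae ((hpot.ae_eq_neg_logZ hψ).mono fun x hx => ?_)
  simp only [gibbsExponent, hx]
  ring_nf

/-- By the symmetric argument, the first Schrödinger potential has linear growth from above. -/
lemma exists_neg_logZ_le (hpot : IsSchrodingerPotentials η ν φ ψ) (hψ : Admissible ν ψ) :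
    ∃ C K : ℝ, 0 ≤ C ∧ 0 ≤ K ∧ ∀ᵐ x ∂η, -logZ ν ψ x ≤ C + K * ‖x‖ := by
  have := hψ.prob
  obtain ⟨C, K, hC, hK, h⟩ := exists_growth_of_lintegral_eq_one (ρ := η) (η := ν) (ψ := φ)
    hpot.measurable_right (hpot.ss1.mono fun x hx => by
      rw [← hx]; congr 1 with y; rw [real_inner_comm, add_comm (φ x)])
  refine ⟨C, K, hC, hK, ?_⟩
  filter_upwards [h, hpot.ae_eq_neg_logZ hψ] with x h1 h2
  rwa [← h2]

end IsSchrodingerPotentials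

/-! ### The Schrödinger problem -/

lemma integrable_add_linear {α : Type*} [MeasurableSpace α] {P : Measure α} [IsFiniteMeasure P]
    {f : α → Rd d} (hf : MemLp f 2 P) (C K : ℝ) : Integrable (fun a => C + K * ‖f a‖) P :=
  (integrable_const C).add ((hf.integrable one_le_two).norm.const_mul K)

section Schrodinger

variable {η ν : Measure (Rd d)} {φ ψ : Rd d → ℝ} {π : Measure (Rd d × Rd d)}

lemma IsSchrodingerPotentials.isCoupling (hpot : IsSchrodingerPotentials η ν φ ψ)
    (hψ : Admissible ν ψ) [IsProbabilityMeasure η] :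
    IsCoupling η ν (η ⊗ₘ hψ.kernel measurable_id) :=
  hψ.isCoupling_compProd (hpot.lintegral_gibbsExponent hψ)

/-- Both Schrödinger potentials are integrable. Their positive parts have linear growth, so that the
exponent of the Gibbs plan is bounded above by an integrable function and is hence integrable under
the plan; the upper bound on either potential then gives a lower bound on the other one. -/
lemma IsSchrodingerPotentials.integrable (hpot : IsSchrodingerPotentials η ν φ ψ)
    (hψ : Admissible ν ψ) (hη : IsP2 η) (hν : IsP2 ν) :
    Integrable ψ ν ∧ Integrable (logZ ν ψ) η := by
  have := hη.1
  have := hν.1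
  have hc := hpot.isCoupling hψ
  have := hc.isProbabilityMeasure
  have htilt : (η.prod ν).tilted (gibbsExponent ν ψ) = η ⊗ₘ hψ.kernel measurable_id :=
    hψ.tilted_eq_compProd measurable_id
  generalize η ⊗ₘ hψ.kernel measurable_id = Q at *
  obtain ⟨C, K, hC, hK, h⟩ := hψ.growth
  obtain ⟨C', K', hC', hK', h'⟩ := hpot.exists_neg_logZ_le hψ
  have hb1 := integrable_add_linear (hc.memLp_fst hη) C' K'
  have hb2 := integrable_add_linear (hc.memLp_snd hν) C K
  have hin := hc.integrable_inner hη hν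
  have hle1 : ∀ᵐ p ∂Q, -logZ ν ψ p.1 ≤ C' + K' * ‖p.1‖ :=
    hc.measurePreserving_fst.quasiMeasurePreserving.ae h'
  have hle2 : ∀ᵐ p ∂Q, ψ p.2 ≤ C + K * ‖p.2‖ :=
    hc.measurePreserving_snd.quasiMeasurePreserving.ae h
  have hexpo : Integrable (gibbsExponent ν ψ) Q := by
    have hb : Integrable (fun p : Rd d × Rd d =>
        (C' + K' * ‖p.1‖) + (C + K * ‖p.2‖) + ⟪p.1, p.2⟫) Q := (hb1.add hb2).add hin
    have hle : ∀ᵐ p ∂Q, gibbsExponent ν ψ p ≤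
        (C' + K' * ‖p.1‖) + (C + K * ‖p.2‖) + ⟪p.1, p.2⟫ := by
      filter_upwards [hle1, hle2] with p h1 h2
      simp only [gibbsExponent]
      linarith
    rw [← htilt] at hb hle ⊢
    have hexp := hψ.integrable_exp_exponent (η := η) measurable_id
    simp only [id] at hexp
    exact integrable_tilted_of_le hψ.measurable_gibbsExponent hexp hb hle
  have hsum := hexpo.sub hin
  have hboth := (hsum.norm.add hb1).add hb2
  -- The sum of the potentials is integrable, so the upper bound on one bounds the other from below.
  have habs : ∀ᵐ p ∂Q,
      |ψ p.2| ≤ |gibbsExponent ν ψ p - ⟪p.1, p.2⟫| + (C' + K' * ‖p.1‖) + (C + K * ‖p.2‖) ∧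
      |logZ ν ψ p.1| ≤ |gibbsExponent ν ψ p - ⟪p.1, p.2⟫| + (C' + K' * ‖p.1‖) + (C + K * ‖p.2‖) := by
    filter_upwards [hle1, hle2] with p h1 h2
    have h3 := neg_abs_le (gibbsExponent ν ψ p - ⟪p.1, p.2⟫)
    have h4 : 0 ≤ C' + K' * ‖p.1‖ := by positivity
    have h5 : 0 ≤ C + K * ‖p.2‖ := by positivity
    have h6 := abs_nonneg (gibbsExponent ν ψ p - ⟪p.1, p.2⟫)
    simp only [abs_le]
    simp only [gibbsExponent] at h3 h6 ⊢
    refine ⟨⟨?_, ?_⟩, ?_, ?_⟩ <;> linarith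
  constructor
  · rw [← hc.measurePreserving_snd.integrable_comp hψ.measurable.aestronglyMeasurable]
    exact hboth.mono' (hψ.measurable.comp measurable_snd).aestronglyMeasurable
      (habs.mono fun p hp => hp.1)
  · rw [← hc.measurePreserving_fst.integrable_comp hψ.measurable_logZ.aestronglyMeasurable]
    exact hboth.mono' (hψ.measurable_logZ.comp measurable_fst).aestronglyMeasurable
      (habs.mono fun p hp => hp.2)

lemma IsCoupling.integrable_gibbsExponent (hπ : IsCoupling η ν π) (hη : IsP2 η) (hν : IsP2 ν)
    (hiψ : Integrable ψ ν) (hiL : Integrable (logZ ν ψ) η) :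
    Integrable (gibbsExponent ν ψ) π :=
  ((hπ.integrable_comp_snd hiψ).add (hπ.integrable_inner hη hν)).sub (hπ.integrable_comp_fst hiL)

lemma IsCoupling.integral_gibbsExponent (hπ : IsCoupling η ν π) (hη : IsP2 η) (hν : IsP2 ν)
    (hiψ : Integrable ψ ν) (hiL : Integrable (logZ ν ψ) η) :
    ∫ p, gibbsExponent ν ψ p ∂π =
      ∫ y, ψ y ∂ν - ∫ x, logZ ν ψ x ∂η + ∫ p, ⟪p.1, p.2⟫ ∂π := by
  have h1 := hπ.integrable_comp_snd hiψ
  have h2 := hπ.integrable_inner hη hν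
  have h12 : Integrable (fun p : Rd d × Rd d => ψ p.2 + ⟪p.1, p.2⟫) π := h1.add h2
  have h3 := hπ.integrable_comp_fst hiL
  simp only [gibbsExponent]
  rw [integral_sub h12 h3, integral_add h1 h2, hπ.integral_comp_fst hiL, hπ.integral_comp_snd hiψ]
  ring

/-- Weak duality for the Schrödinger problem. -/
lemma Admissible.le_spValue (hψ : Admissible ν ψ) (hη : IsP2 η) (hν : IsP2 ν)
    (hiψ : Integrable ψ ν) (hiL : Integrable (logZ ν ψ) η) :
    ((∫ y, ψ y ∂ν - ∫ x, logZ ν ψ x ∂η : ℝ) : EReal) ≤ spValue η ν := by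
  have := hη.1
  have := hν.1
  refine le_iInf₂ fun π hπ => ?_
  have := hπ.isProbabilityMeasure
  have h := integral_le_klDiv (P := η.prod ν) (hψ.integrable_exp_exponent measurable_id)
    (hψ.integral_exp_exponent measurable_id) (hπ.integrable_gibbsExponent hη hν hiψ hiL)
  have h2 := hπ.integral_gibbsExponent hη hν hiψ hiL
  simp only [id] at h
  rw [h2, EReal.coe_add] at h
  rw [spCost]
  exact EReal.le_sub_iff_add_le (Or.inl (EReal.coe_ne_bot _)) (Or.inl (EReal.coe_ne_top _)) |>.2 h

/-- The Gibbs plan of the Schrödinger potentials attains the dual lower bound. -/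
lemma IsSchrodingerPotentials.spCost_eq (hpot : IsSchrodingerPotentials η ν φ ψ)
    (hψ : Admissible ν ψ) (hη : IsP2 η) (hν : IsP2 ν) [IsProbabilityMeasure η] :
    spCost η ν (η ⊗ₘ hψ.kernel measurable_id) =
      ((∫ y, ψ y ∂ν - ∫ x, logZ ν ψ x ∂η : ℝ) : EReal) := by
  have := hν.1
  obtain ⟨hiψ, hiL⟩ := hpot.integrable hψ hη hν
  have hc := hpot.isCoupling hψ
  have htilt := hψ.tilted_eq_compProd (η := η) measurable_id
  have h := klDiv_tilted_self (P := η.prod ν) (hψ.integrable_exp_exponent measurable_id)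
    (hψ.integral_exp_exponent measurable_id)
    (by rw [htilt]; exact hc.integrable_gibbsExponent hη hν hiψ hiL)
  rw [htilt] at h
  simp only [id] at h
  rw [spCost, h, hc.integral_gibbsExponent hη hν hiψ hiL, ← EReal.coe_sub]
  congr 1
  ring

lemma IsSchrodingerPotentials.spValue_eq (hpot : IsSchrodingerPotentials η ν φ ψ)
    (hψ : Admissible ν ψ) (hη : IsP2 η) (hν : IsP2 ν) :
    spValue η ν = ((∫ y, ψ y ∂ν - ∫ x, logZ ν ψ x ∂η : ℝ) : EReal) := by
  have := hη.1
  obtain ⟨hiψ, hiL⟩ := hpot.integrable hψ hη hν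
  refine le_antisymm ?_ (hψ.le_spValue hη hν hiψ hiL)
  rw [← hpot.spCost_eq hψ hη hν]
  exact iInf₂_le _ (hpot.isCoupling hψ)

/-- The solution of the Schrödinger problem is the Gibbs plan of the Schrödinger potentials: the
cost of a coupling exceeds the value by its relative entropy with respect to that plan. -/
lemma SolvesSP.eq_compProd (hπ : SolvesSP η ν π) (hpot : IsSchrodingerPotentials η ν φ ψ)
    (hψ : Admissible ν ψ) (hη : IsP2 η) (hν : IsP2 ν) :
    π = η ⊗ₘ hψ.kernel measurable_id := by
  have := hη.1
  have := hν.1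
  have := hπ.1.isProbabilityMeasure
  obtain ⟨hiψ, hiL⟩ := hpot.integrable hψ hη hν
  have hcost := hπ.2
  rw [hpot.spValue_eq hψ hη hν, spCost] at hcost
  have hfin : klDiv π (η.prod ν) ≠ ⊤ := fun htop => by
    rw [htop, EReal.coe_ennreal_top, EReal.top_sub_coe] at hcost
    exact EReal.coe_ne_top _ hcost.symm
  rw [← EReal.coe_ennreal_toReal hfin, ← EReal.coe_sub, EReal.coe_eq_coe_iff] at hcost
  obtain ⟨hfin', h⟩ := toReal_klDiv_eq_add_integral (P := η.prod ν)
    (hψ.integrable_exp_exponent measurable_id) (hψ.integral_exp_exponent measurable_id)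
    (hπ.1.integrable_gibbsExponent hη hν hiψ hiL) hfin
  have h2 := hπ.1.integral_gibbsExponent hη hν hiψ hiL
  rw [hψ.tilted_eq_compProd measurable_id] at h hfin'
  simp only [id] at h
  rw [h2] at h
  rw [← klDiv_eq_zero_iff]
  have h0 : (klDiv π (η ⊗ₘ hψ.kernel measurable_id)).toReal = 0 := by linarith
  exact ((ENNReal.toReal_eq_zero_iff _).1 h0).resolve_right hfin'

end Schrodinger

/-! ### Optimality in the variational problem -/

section Variational

variable {η μ ν : Measure (Rd d)} {ψ : Rd d → ℝ}

lemma isCoupling_prod [IsProbabilityMeasure η] [IsProbabilityMeasure μ] :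
    IsCoupling η μ (η.prod μ) :=
  ⟨by simp [Measure.fst], by simp [Measure.snd]⟩

/-- The maximal covariance of two measures with finite second moments is a real number, and it is
approximated by the covariances of couplings. -/
lemma exists_mcov_eq (hη : IsP2 η) (hμ : IsP2 μ) :
    ∃ M : ℝ, mcov η μ = M ∧
      ∀ ε > 0, ∃ κ, IsCoupling η μ κ ∧ M - ε < ∫ p, ⟪p.1, p.2⟫ ∂κ := by
  have := hη.1
  have := hμ.1
  set B := ∫ x, ‖x‖ ^ 2 ∂η + ∫ x, ‖x‖ ^ 2 ∂μ with hB
  have hi1 : Integrable (fun x : Rd d => ‖x‖ ^ 2) η := hη.2.integrable_norm_pow two_ne_zero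
  have hi2 : Integrable (fun x : Rd d => ‖x‖ ^ 2) μ := hμ.2.integrable_norm_pow two_ne_zero
  have hle : mcov η μ ≤ (B : EReal) := by
    refine iSup₂_le fun κ hκ => ?_
    rw [EReal.coe_le_coe_iff, hB, ← hκ.integral_comp_fst hi1, ← hκ.integral_comp_snd hi2,
      ← integral_add (hκ.integrable_comp_fst hi1) (hκ.integrable_comp_snd hi2)]
    refine integral_mono (hκ.integrable_inner hη hμ)
      ((hκ.integrable_comp_fst hi1).add (hκ.integrable_comp_snd hi2)) fun p => ?_
    have := real_inner_le_norm p.1 p.2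
    nlinarith [sq_nonneg (‖p.1‖ - ‖p.2‖), sq_nonneg ‖p.1‖, sq_nonneg ‖p.2‖]
  have hbot : mcov η μ ≠ ⊥ := fun h => by
    have := le_iSup₂ (f := fun κ (_ : IsCoupling η μ κ) => ((∫ p, ⟪p.1, p.2⟫ ∂κ : ℝ) : EReal))
      (η.prod μ) isCoupling_prod
    rw [← mcov] at this
    rw [h, le_bot_iff] at this
    exact EReal.coe_ne_bot _ this
  have htop : mcov η μ ≠ ⊤ := fun h => by
    rw [h, top_le_iff] at hle
    exact EReal.coe_ne_top _ hle
  have hM := EReal.coe_toReal htop hbot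
  refine ⟨(mcov η μ).toReal, hM.symm, fun ε hε => ?_⟩
  have h1 : (((mcov η μ).toReal - ε : ℝ) : EReal) < mcov η μ := by
    conv_rhs => rw [← hM]
    exact EReal.coe_lt_coe_iff.2 (by linarith)
  rw [mcov, lt_iSup_iff] at h1
  obtain ⟨κ, h2⟩ := h1
  rw [lt_iSup_iff] at h2
  obtain ⟨hκ, h3⟩ := h2
  exact ⟨κ, hκ, EReal.coe_lt_coe_iff.1 h3⟩

/-- A maximizer of the variational problem maximizes the functional obtained by replacing the
value of the Schrödinger problem by its dual lower bound. -/
lemma SolvesVP.le_of_isCoupling (hVP : SolvesVP μ ν η) (hψ : Admissible ν ψ) (hν : IsP2 ν)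
    (hiψ : Integrable ψ ν)
    (hsp : spValue η ν = ((∫ y, ψ y ∂ν - ∫ x, logZ ν ψ x ∂η : ℝ) : EReal)) {M : ℝ}
    (hM : mcov η μ = M) {η' : Measure (Rd d)} (hη' : IsP2 η')
    (hiL' : Integrable (logZ ν ψ) η') {κ : Measure (Rd d × Rd d)} (hκ : IsCoupling η' μ κ) :
    ∫ p, ⟪p.1, p.2⟫ ∂κ - ∫ x, logZ ν ψ x ∂η' ≤ M - ∫ x, logZ ν ψ x ∂η := by
  have h1 : vpFun μ ν η' ≤ vpFun μ ν η := by
    rw [hVP.2]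
    exact le_iSup₂ (f := fun η (_ : IsP2 η) => vpFun μ ν η) η' hη'
  have h2 : ((∫ p, ⟪p.1, p.2⟫ ∂κ : ℝ) : EReal) ≤ mcov η' μ :=
    le_iSup₂ (f := fun κ (_ : IsCoupling η' μ κ) => ((∫ p, ⟪p.1, p.2⟫ ∂κ : ℝ) : EReal)) κ hκ
  have h3 := (add_le_add (hψ.le_spValue hη' hν hiψ hiL') h2).trans h1
  rw [vpFun, hsp, hM, ← EReal.coe_add, ← EReal.coe_add, EReal.coe_le_coe_iff] at h3
  linarith

/-- Optimality against the image of a coupling under a bounded measurable displacement of the first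
coordinate. -/
lemma SolvesVP.integral_displacement_le (hVP : SolvesVP μ ν η) (hψ : Admissible ν ψ) (hν : IsP2 ν)
    (hμ : IsP2 μ) (hiψ : Integrable ψ ν) (hiL : Integrable (logZ ν ψ) η)
    (hsp : spValue η ν = ((∫ y, ψ y ∂ν - ∫ x, logZ ν ψ x ∂η : ℝ) : EReal)) {M : ℝ}
    (hM : mcov η μ = M) {κ : Measure (Rd d × Rd d)} (hκ : IsCoupling η μ κ)
    {w : Rd d × Rd d → Rd d} (hw : Measurable w) (hw1 : ∀ p, ‖w p‖ ≤ 1)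
    (hiLw : Integrable (fun p => logZ ν ψ (p.1 + w p)) κ) :
    Integrable (fun p => ⟪w p, p.2⟫ - (logZ ν ψ (p.1 + w p) - logZ ν ψ p.1)) κ ∧
    ∫ p, (⟪w p, p.2⟫ - (logZ ν ψ (p.1 + w p) - logZ ν ψ p.1)) ∂κ ≤ M - ∫ p, ⟪p.1, p.2⟫ ∂κ := by
  have := hVP.1.1
  have := hκ.isProbabilityMeasure
  have hS : Measurable fun p : Rd d × Rd d => p.1 + w p := measurable_fst.add hw
  have hSP : Measurable fun p : Rd d × Rd d => (p.1 + w p, p.2) := hS.prodMk measurable_snd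
  have hwL : MemLp w 2 κ :=
    MemLp.of_bound hw.aestronglyMeasurable 1 (Filter.Eventually.of_forall hw1)
  have hSL : MemLp (fun p : Rd d × Rd d => p.1 + w p) 2 κ := (hκ.memLp_fst hVP.1).add hwL
  have hη' : IsP2 (κ.map fun p => p.1 + w p) :=
    ⟨Measure.isProbabilityMeasure_map hS.aemeasurable,
      (memLp_map_measure_iff stronglyMeasurable_id.aestronglyMeasurable hS.aemeasurable).2 hSL⟩
  have hκ' : IsCoupling (κ.map fun p => p.1 + w p) μ (κ.map fun p => (p.1 + w p, p.2)) := by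
    refine ⟨?_, ?_⟩
    · rw [Measure.fst, Measure.map_map measurable_fst hSP]; rfl
    · rw [Measure.snd, Measure.map_map measurable_snd hSP]; exact hκ.2
  have h := hVP.le_of_isCoupling hψ hν hiψ hsp hM hη'
    ((integrable_map_measure hψ.measurable_logZ.aestronglyMeasurable hS.aemeasurable).2 hiLw) hκ'
  rw [integral_map hSP.aemeasurable (Continuous.aestronglyMeasurable (by fun_prop)),
    integral_map hS.aemeasurable hψ.measurable_logZ.aestronglyMeasurable,
    ← hκ.integral_comp_fst hiL] at h
  have hi1 := integrable_inner_of_memLp hwL (hκ.memLp_snd hμ)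
  have hi2 := hκ.integrable_comp_fst hiL
  have hi12 : Integrable (fun p => logZ ν ψ (p.1 + w p) - logZ ν ψ p.1) κ := hiLw.sub hi2
  refine ⟨hi1.sub hi12, ?_⟩
  have e1 : ∫ p, ⟪p.1 + w p, p.2⟫ ∂κ = ∫ p, ⟪p.1, p.2⟫ ∂κ + ∫ p, ⟪w p, p.2⟫ ∂κ := by
    rw [← integral_add (hκ.integrable_inner hVP.1 hμ) hi1]
    simp_rw [inner_add_left]
  rw [integral_sub hi1 hi12, integral_sub hiLw hi2]
  simp only at h
  linarith

/-- Along a coupling of nearly maximal covariance, the second coordinate is close to the barycentric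
image of the first. Otherwise a displacement of the first coordinate by a small multiple of
`(p.2 - T p.1) / ‖p.2 - T p.1‖` improves the objective of the variational problem to first order,
while the error is of second order because `T` is locally Lipschitz. -/
lemma SolvesVP.exists_mul_measureReal_le (hVP : SolvesVP μ ν η) (hψ : Admissible ν ψ)
    (hplane : NotOnHyperplane ν) (hν : IsP2 ν)
    (hμ : IsP2 μ) (hiψ : Integrable ψ ν) (hiL : Integrable (logZ ν ψ) η)
    (hsp : spValue η ν = ((∫ y, ψ y ∂ν - ∫ x, logZ ν ψ x ∂η : ℝ) : EReal)) {M : ℝ}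
    (hM : mcov η μ = M) (R : ℝ) {δ : ℝ} (hδ : 0 < δ) :
    ∃ a > 0, ∀ κ, IsCoupling η μ κ →
      a * κ.real {p | ‖p.1‖ ≤ R ∧ δ ≤ ‖p.2 - baryMap ν ψ p.1‖} ≤ M - ∫ p, ⟪p.1, p.2⟫ ∂κ := by
  have := hVP.1.1
  have hcomp : IsCompact (Metric.closedBall (0 : Rd d) (R + 1)) := isCompact_closedBall _ _
  obtain ⟨K, hK⟩ : ∃ K, LipschitzOnWith K (baryMap ν ψ) (Metric.closedBall (0 : Rd d) (R + 1)) :=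
    LocallyLipschitzOn.exists_lipschitzOnWith_of_compact hcomp
      ((hψ.contDiff_baryMap.of_le (by simp)).locallyLipschitz.locallyLipschitzOn)
  obtain ⟨b, hb⟩ := hcomp.exists_bound_of_continuousOn hψ.contDiff_logZ.continuous.continuousOn
  -- The step size `t` is so small that the second-order error `K * t ^ 2` is at most half of the
  -- first-order gain `t * δ`, and that displaced points stay within the ball of radius `R + 1`.
  set t : ℝ := δ / (2 * K + δ + 1) with ht
  have hK0 : (0 : ℝ) ≤ K := K.2
  have ht0 : 0 < t := by positivity
  have ht1 : t ≤ 1 := by rw [ht, div_le_one (by positivity)]; linarith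
  have htK : K * t ≤ δ / 2 := by
    rw [ht, mul_div_assoc', div_le_iff₀ (by positivity)]
    nlinarith
  refine ⟨t * (δ / 2), by positivity, fun κ hκ => ?_⟩
  have := hκ.isProbabilityMeasure
  set A : Set (Rd d × Rd d) := {p | ‖p.1‖ ≤ R ∧ δ ≤ ‖p.2 - baryMap ν ψ p.1‖} with hA
  have hr : Measurable fun p : Rd d × Rd d => p.2 - baryMap ν ψ p.1 :=
    measurable_snd.sub (hψ.measurable_baryMap.comp measurable_fst)
  have hAm : MeasurableSet A :=
    (measurableSet_le measurable_fst.norm measurable_const).inter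
      (measurableSet_le measurable_const hr.norm)
  set w : Rd d × Rd d → Rd d := A.indicator fun p =>
    (t / ‖p.2 - baryMap ν ψ p.1‖) • (p.2 - baryMap ν ψ p.1) with hw
  have hwm : Measurable w := ((measurable_const.div hr.norm).smul hr).indicator hAm
  have hwA : ∀ p ∈ A, w p = (t / ‖p.2 - baryMap ν ψ p.1‖) • (p.2 - baryMap ν ψ p.1) :=
    fun p hp => indicator_of_mem hp _
  have hwA' : ∀ p ∉ A, w p = 0 := fun p hp => indicator_of_notMem hp _
  have hwn : ∀ p ∈ A, ‖w p‖ = t := fun p hp => by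
    rw [hwA p hp, norm_smul, Real.norm_of_nonneg (by positivity), div_mul_cancel₀]
    exact (hδ.trans_le hp.2).ne'
  have hw1 : ∀ p, ‖w p‖ ≤ 1 := fun p => by
    by_cases hp : p ∈ A
    · rw [hwn p hp]; exact ht1
    · simp [hwA' p hp]
  have hball : ∀ p ∈ A, p.1 + w p ∈ Metric.closedBall (0 : Rd d) (R + 1) := fun p hp => by
    rw [mem_closedBall_zero_iff]
    exact (norm_add_le _ _).trans (add_le_add hp.1 (hw1 p))
  have hiLw : Integrable (fun p => logZ ν ψ (p.1 + w p)) κ := by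
    refine Integrable.mono' ((hκ.integrable_comp_fst hiL).norm.add (integrable_const |b|))
      (hψ.measurable_logZ.comp (measurable_fst.add hwm)).aestronglyMeasurable
      (Filter.Eventually.of_forall fun p => ?_)
    simp only [Pi.add_apply]
    by_cases hp : p ∈ A
    · linarith [hb _ (hball p hp), norm_nonneg (logZ ν ψ p.1), le_abs_self b]
    · rw [hwA' p hp, add_zero]
      linarith [abs_nonneg b]
  obtain ⟨hint, hle⟩ := hVP.integral_displacement_le hψ hν hμ hiψ hiL hsp hM hκ hwm hw1 hiLw
  refine le_trans ?_ hle
  have e : t * (δ / 2) * κ.real A = ∫ p, A.indicator (fun _ => t * (δ / 2)) p ∂κ := by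
    rw [integral_indicator_const _ hAm, smul_eq_mul, mul_comm]
  rw [e]
  refine integral_mono ((integrable_const _).indicator hAm) hint fun p => ?_
  by_cases hp : p ∈ A
  · simp only [indicator_of_mem hp]
    set r := p.2 - baryMap ν ψ p.1 with hrp
    have hr0 : 0 < ‖r‖ := hδ.trans_le hp.2
    -- By convexity the increment of `logZ` is at most the slope at the displaced point.
    have h1 := hψ.logZ_add_inner_le hplane p.1 (p.1 + w p)
    rw [sub_add_cancel_left, inner_neg_left] at h1
    have h2 : ⟪w p, baryMap ν ψ (p.1 + w p) - baryMap ν ψ p.1⟫ ≤ t * (K * t) := by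
      refine (real_inner_le_norm _ _).trans ?_
      rw [hwn p hp]
      gcongr
      have h3 := hK.dist_le_mul _ (hball p hp) p.1
        (mem_closedBall_zero_iff.2 (hp.1.trans (by linarith)))
      rwa [dist_eq_norm, dist_eq_norm, add_sub_cancel_left, hwn p hp] at h3
    have h4 : ⟪w p, r⟫ = t * ‖r‖ := by
      rw [hwA p hp, ← hrp, inner_smul_left, real_inner_self_eq_norm_sq]
      simp only [RCLike.conj_to_real]
      field_simp
    have h5 : ⟪w p, p.2⟫ = ⟪w p, r⟫ + ⟪w p, baryMap ν ψ p.1⟫ := by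
      rw [← inner_add_right, hrp, sub_add_cancel]
    rw [inner_sub_right] at h2
    have h6 : t * δ ≤ t * ‖r‖ := by gcongr; exact hp.2
    have h7 : t * (K * t) ≤ t * (δ / 2) := by gcongr
    linarith
  · simp [indicator_of_notMem hp, hwA' p hp]

lemma norm_exp_mul_I_sub_le (a b : ℝ) :
    ‖Complex.exp (a * Complex.I) - Complex.exp (b * Complex.I)‖ ≤ |a - b| := by
  have h : Complex.exp (a * Complex.I) - Complex.exp (b * Complex.I) =
      Complex.exp (b * Complex.I) * (Complex.exp (Complex.I * ((a - b : ℝ) : ℂ)) - 1) := by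
    rw [mul_sub, ← Complex.exp_add]
    push_cast
    ring_nf
  rw [h, norm_mul, Complex.norm_exp_ofReal_mul_I, one_mul]
  exact Real.norm_exp_I_mul_ofReal_sub_one_le

/-- If under suitable couplings of `η` and `μ` the second coordinate is arbitrarily close, in
probability, to the image of the first one under `T`, then `T` pushes `η` forward to `μ`: the
characteristic functions agree. -/
lemma map_eq_of_forall_coupling [IsProbabilityMeasure η] [IsProbabilityMeasure μ]
    {T : Rd d → Rd d} (hT : Measurable T)
    (h : ∀ δ > 0, ∀ ε > 0, ∃ κ, IsCoupling η μ κ ∧ κ.real {p | δ ≤ ‖p.2 - T p.1‖} ≤ ε) :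
    η.map T = μ := by
  have := Measure.isProbabilityMeasure_map hT.aemeasurable (μ := η)
  refine Measure.ext_of_charFun (funext fun t => ?_)
  rw [← sub_eq_zero, ← norm_le_zero_iff]
  refine le_of_forall_pos_le_add fun ε hε => ?_
  set δ := ε / (2 * (‖t‖ + 1)) with hδ
  have hδ0 : 0 < δ := by positivity
  have hδt : δ * ‖t‖ ≤ ε / 2 := by
    rw [hδ, div_mul_eq_mul_div, div_le_iff₀ (by positivity)]
    nlinarith [norm_nonneg t]
  obtain ⟨κ, hκ, hκε⟩ := h δ hδ0 (ε / 4) (by positivity)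
  have := hκ.isProbabilityMeasure
  set A : Set (Rd d × Rd d) := {p | δ ≤ ‖p.2 - T p.1‖} with hA
  have hAm : MeasurableSet A := measurableSet_le measurable_const
    (measurable_snd.sub (hT.comp measurable_fst)).norm
  have hf : Measurable fun x : Rd d => Complex.exp ((⟪x, t⟫ : ℝ) * Complex.I) := by fun_prop
  have hi : ∀ {α : Type} [MeasurableSpace α] (P : Measure α) [IsFiniteMeasure P] {f : α → Rd d},
      Measurable f → Integrable (fun a => Complex.exp ((⟪f a, t⟫ : ℝ) * Complex.I)) P := by
    intro α _ P _ f hfm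
    exact Integrable.of_bound (hf.comp hfm).aestronglyMeasurable 1
      (Filter.Eventually.of_forall fun a => (Complex.norm_exp_ofReal_mul_I _).le)
  have hi1 := hi κ (f := fun p : Rd d × Rd d => T p.1) (hT.comp measurable_fst)
  have hi2 := hi κ (f := Prod.snd) measurable_snd
  have e1 : charFun (η.map T) t = ∫ p, Complex.exp ((⟪T p.1, t⟫ : ℝ) * Complex.I) ∂κ := by
    rw [charFun_apply, integral_map hT.aemeasurable hf.aestronglyMeasurable,
      ← hκ.integral_comp_fst (hi η hT)]
  have e2 : charFun μ t = ∫ p, Complex.exp ((⟪p.2, t⟫ : ℝ) * Complex.I) ∂κ := by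
    rw [charFun_apply, hκ.integral_comp_snd (f := fun x =>
      Complex.exp ((⟪x, t⟫ : ℝ) * Complex.I)) (hi μ measurable_id)]
  rw [e1, e2, ← integral_sub hi1 hi2, zero_add]
  have hbound : ∀ p : Rd d × Rd d, ‖Complex.exp ((⟪T p.1, t⟫ : ℝ) * Complex.I) -
      Complex.exp ((⟪p.2, t⟫ : ℝ) * Complex.I)‖ ≤ ε / 2 + A.indicator (fun _ => (2 : ℝ)) p := by
    intro p
    by_cases hp : p ∈ A
    · rw [indicator_of_mem hp]
      refine (norm_sub_le _ _).trans ?_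
      rw [Complex.norm_exp_ofReal_mul_I, Complex.norm_exp_ofReal_mul_I]
      linarith
    · rw [indicator_of_notMem hp, add_zero]
      refine (norm_exp_mul_I_sub_le _ _).trans ?_
      rw [← inner_sub_left]
      refine (abs_real_inner_le_norm _ _).trans (le_trans ?_ hδt)
      gcongr
      rw [norm_sub_rev]
      exact (not_le.1 hp).le
  refine (norm_integral_le_integral_norm _).trans ?_
  have hi3 : Integrable (A.indicator fun _ => (2 : ℝ)) κ := (integrable_const _).indicator hAm
  refine (integral_mono (hi1.sub hi2).norm ((integrable_const (ε / 2)).add hi3) hbound).trans ?_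
  simp only [Pi.add_apply]
  rw [integral_add (integrable_const _) hi3, integral_indicator_const _ hAm]
  simp only [integral_const, probReal_univ, smul_eq_mul]
  linarith

/-- First-order optimality in the variational problem: the barycentric map pushes the maximizer
forward to `μ`. -/
lemma SolvesVP.map_baryMap (hVP : SolvesVP μ ν η) (hψ : Admissible ν ψ)
    (hplane : NotOnHyperplane ν) (hν : IsP2 ν)
    (hμ : IsP2 μ) (hiψ : Integrable ψ ν) (hiL : Integrable (logZ ν ψ) η)
    (hsp : spValue η ν = ((∫ y, ψ y ∂ν - ∫ x, logZ ν ψ x ∂η : ℝ) : EReal)) :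
    η.map (baryMap ν ψ) = μ := by
  have := hVP.1.1
  have := hμ.1
  obtain ⟨M, hM, happrox⟩ := exists_mcov_eq hVP.1 hμ
  refine map_eq_of_forall_coupling hψ.measurable_baryMap fun δ hδ ε hε => ?_
  set I := ∫ x : Rd d, ‖x‖ ∂η with hI
  have hI0 : 0 ≤ I := integral_nonneg fun x => norm_nonneg x
  set R := 2 * (I + 1) / ε with hR
  have hR0 : 0 < R := by positivity
  have htail : η.real {x | R ≤ ‖x‖} ≤ ε / 2 := by
    have h := mul_meas_ge_le_integral_of_nonneg (μ := η)
      (Filter.Eventually.of_forall fun x : Rd d => norm_nonneg x) hVP.1.integrable_norm R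
    rw [← hI] at h
    have h1 : R * (ε / 2) = I + 1 := by rw [hR]; field_simp
    by_contra! hlt
    nlinarith
  obtain ⟨a, ha, hmain⟩ := hVP.exists_mul_measureReal_le hψ hplane hν hμ hiψ hiL hsp hM R hδ
  obtain ⟨κ, hκ, hκM⟩ := happrox (a * (ε / 2)) (by positivity)
  have := hκ.isProbabilityMeasure
  refine ⟨κ, hκ, ?_⟩
  have h1 : κ.real {p | ‖p.1‖ ≤ R ∧ δ ≤ ‖p.2 - baryMap ν ψ p.1‖} ≤ ε / 2 := by
    have := hmain κ hκ
    by_contra! hlt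
    nlinarith
  have h2 : κ.real (Prod.fst ⁻¹' {x | R ≤ ‖x‖}) ≤ ε / 2 := by
    rwa [measureReal_def, hκ.measurePreserving_fst.measure_preimage
      (measurableSet_le measurable_const measurable_norm).nullMeasurableSet]
  refine (measureReal_mono (s₂ := {p | ‖p.1‖ ≤ R ∧ δ ≤ ‖p.2 - baryMap ν ψ p.1‖} ∪
    Prod.fst ⁻¹' {x | R ≤ ‖x‖}) fun p hp => ?_).trans
      ((measureReal_union_le _ _).trans (by linarith))
  rcases le_total ‖p.1‖ R with h | h
  · exact Or.inl ⟨h, hp⟩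
  · exact Or.inr h

end Variational

/-! ### The primal problem -/

/-- The pull-out property: against a function of the first coordinate, the second coordinate of a
martingale coupling may be replaced by the first one. -/
lemma IsMartingaleCoupling.integral_inner {μ ν : Measure (Rd d)} {m : Measure (Rd d × Rd d)}
    (hm : IsMartingaleCoupling μ ν m) (hμ : IsP2 μ) (hν : IsP2 ν) {h : Rd d → Rd d}
    (hh : Measurable h) (hL : MemLp h 2 μ) :
    Integrable (fun p => ⟪h p.1, p.2⟫) m ∧ ∫ p, ⟪h p.1, p.2⟫ ∂m = ∫ x, ⟪h x, x⟫ ∂μ := by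
  have := hμ.1
  have := hm.1.isProbabilityMeasure
  have hhL : MemLp (fun p : Rd d × Rd d => h p.1) 2 m :=
    hL.comp_measurePreserving hm.1.measurePreserving_fst
  have hi := integrable_inner_of_memLp hhL (hm.1.memLp_snd hν)
  refine ⟨hi, ?_⟩
  have hle : MeasurableSpace.comap (Prod.fst : Rd d × Rd d → Rd d) inferInstance ≤
    (inferInstance : MeasurableSpace (Rd d × Rd d)) := measurable_fst.comap_le
  have hfm : AEStronglyMeasurable[MeasurableSpace.comap (Prod.fst : Rd d × Rd d → Rd d)
      inferInstance] (fun p : Rd d × Rd d => h p.1) m :=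
    (hh.comp (comap_measurable _)).stronglyMeasurable.aestronglyMeasurable
  have hpull := condExp_bilin_of_aestronglyMeasurable_left
    (innerSL ℝ : Rd d →L[ℝ] Rd d →L[ℝ] ℝ) hfm hi ((hm.1.memLp_snd hν).integrable one_le_two)
  rw [← integral_condExp hle,
    ← hm.1.integral_comp_fst (integrable_inner_of_memLp hL hμ.2)]
  refine integral_congr_ae ?_
  filter_upwards [hpull, hm.2] with p h1 h2
  have h3 : (m[(fun p : Rd d × Rd d => p.2) | MeasurableSpace.comap
    (Prod.fst : Rd d × Rd d → Rd d) inferInstance]) p = p.1 := h2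
  rw [h3] at h1
  exact h1

/-- The relations between the marginals `μ` and `ν`, the maximizer `η` of the variational problem,
the potential `ψ` and a measurable left inverse `h` of the barycentric map on which the
optimality of the Gibbs plan in the primal and in the dual problem rests. -/
structure OptimalPotential (μ ν η : Measure (Rd d)) (ψ : Rd d → ℝ) (h : Rd d → Rd d) : Prop where
  admissible : Admissible ν ψ
  notOnHyperplane : NotOnHyperplane ν
  isP2_first : IsP2 μ
  isP2_second : IsP2 ν
  isP2_source : IsP2 η
  integrable_potential : Integrable ψ ν
  integrable_logZ : Integrable (logZ ν ψ) η
  isCoupling : IsCoupling η ν (η ⊗ₘ admissible.kernel measurable_id)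
  map_baryMap : η.map (baryMap ν ψ) = μ
  measurable_inverse : Measurable h
  leftInverse : Function.LeftInverse h (baryMap ν ψ)

namespace OptimalPotential

variable {μ ν η : Measure (Rd d)} {ψ : Rd d → ℝ} {h : Rd d → Rd d}

/-- Almost every point for `μ` lies in the range of the barycentric map. -/
lemma ae_of_forall_baryMap (H : OptimalPotential μ ν η ψ h) {p : Rd d → Prop}
    (hp : ∀ z, p (baryMap ν ψ z)) : ∀ᵐ x ∂μ, p x := by
  rw [← H.map_baryMap,
    (H.admissible.measurableEmbedding_baryMap H.notOnHyperplane).ae_map_iff]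
  exact Filter.Eventually.of_forall hp

lemma map_inverse (H : OptimalPotential μ ν η ψ h) : μ.map h = η := by
  rw [← H.map_baryMap, Measure.map_map H.measurable_inverse H.admissible.measurable_baryMap,
    H.leftInverse.comp_eq_id, Measure.map_id]

lemma measurePreserving_inverse (H : OptimalPotential μ ν η ψ h) : MeasurePreserving h μ η :=
  ⟨H.measurable_inverse, H.map_inverse⟩

lemma memLp_inverse (H : OptimalPotential μ ν η ψ h) : MemLp h 2 μ :=
  H.isP2_source.2.comp_measurePreserving H.measurePreserving_inverse

lemma integrable_logZ_inverse (H : OptimalPotential μ ν η ψ h) :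
    Integrable (fun x => logZ ν ψ (h x)) μ :=
  H.measurePreserving_inverse.integrable_comp_of_integrable H.integrable_logZ

lemma integrable_inner_inverse (H : OptimalPotential μ ν η ψ h) :
    Integrable (fun x => ⟪h x, x⟫) μ :=
  integrable_inner_of_memLp H.memLp_inverse H.isP2_first.2

lemma baryPlan_eq (H : OptimalPotential μ ν η ψ h) :
    baryPlan (baryMap ν ψ) (η ⊗ₘ H.admissible.kernel measurable_id) =
      μ ⊗ₘ H.admissible.kernel H.measurable_inverse := by
  have := H.isP2_source.1
  have := H.isP2_first.1
  have hT := H.admissible.measurable_baryMap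
  have hTm : Measurable fun p : Rd d × Rd d => (baryMap ν ψ p.1, p.2) := by fun_prop
  ext s hs
  rw [baryPlan, Measure.map_apply hTm hs, Measure.compProd_apply (hTm hs),
    Measure.compProd_apply hs]
  have hmap := lintegral_map (μ := η) (Kernel.measurable_kernel_prodMk_left
    (κ := H.admissible.kernel H.measurable_inverse) hs) hT
  rw [H.map_baryMap] at hmap
  rw [hmap]
  congr 1 with z
  rw [Admissible.kernel_apply, Admissible.kernel_apply, H.leftInverse z]
  rfl

lemma isCoupling_baryPlan (H : OptimalPotential μ ν η ψ h) :
    IsCoupling μ ν (μ ⊗ₘ H.admissible.kernel H.measurable_inverse) := by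
  have := H.isP2_source.1
  have := H.isP2_first.1
  have hT := H.admissible.measurable_baryMap
  refine ⟨Measure.fst_compProd _ _, ?_⟩
  rw [← H.baryPlan_eq, baryPlan, Measure.snd, Measure.map_map measurable_snd (by fun_prop)]
  exact H.isCoupling.2

/-- The disintegration of the barycentric image of the Gibbs plan, for every extension of the
inverse of the barycentric map. -/
lemma condKernel_eq_gibbs (H : OptimalPotential μ ν η ψ h) {m : Measure (Rd d × Rd d)}
    [IsFiniteMeasure m] (hm : m = μ ⊗ₘ H.admissible.kernel H.measurable_inverse)
    {h' : Rd d → Rd d} (hh' : Function.LeftInverse h' (baryMap ν ψ)) :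
    ∀ᵐ x ∂μ, m.condKernel x = gibbs ν ψ (h' x) := by
  have := H.isP2_first.1
  have hfst : m.fst = μ := by rw [hm, Measure.fst_compProd]
  have h1 := eq_condKernel_of_measure_eq_compProd (ρ := m)
    (H.admissible.kernel H.measurable_inverse) (by rw [hfst]; exact hm)
  rw [hfst] at h1
  filter_upwards [h1, H.ae_of_forall_baryMap (p := fun x => h x = h' x) fun z => by
    rw [H.leftInverse z, hh' z]] with x h2 h3
  rw [← h2, Admissible.kernel_apply, h3]

/-- The Gibbs measure at `h x` has barycenter `x`. -/
lemma isMartingaleCoupling (H : OptimalPotential μ ν η ψ h) :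
    IsMartingaleCoupling μ ν (μ ⊗ₘ H.admissible.kernel H.measurable_inverse) := by
  have := H.isP2_first.1
  have hc := H.isCoupling_baryPlan
  refine ⟨hc, ?_⟩
  set m := μ ⊗ₘ H.admissible.kernel H.measurable_inverse with hm
  have hi1 : Integrable (fun p : Rd d × Rd d => p.1) m :=
    (hc.memLp_fst H.isP2_first).integrable one_le_two
  have hi2 : Integrable (fun p : Rd d × Rd d => p.2) m :=
    (hc.memLp_snd H.isP2_second).integrable one_le_two
  refine (ae_eq_condExp_of_forall_setIntegral_eq measurable_fst.comap_le hi2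
    (fun s _ _ => hi1.integrableOn) ?_
    (comap_measurable _).stronglyMeasurable.aestronglyMeasurable).symm
  rintro _ ⟨B, hB, rfl⟩ -
  have e : (Prod.fst ⁻¹' B : Set (Rd d × Rd d)) = B ×ˢ univ := by ext p; simp
  rw [e, hm, Measure.setIntegral_compProd hB MeasurableSet.univ hi1.integrableOn,
    Measure.setIntegral_compProd hB MeasurableSet.univ hi2.integrableOn]
  refine setIntegral_congr_ae hB ?_
  refine H.ae_of_forall_baryMap fun z _ => ?_
  rw [setIntegral_univ, setIntegral_univ, Admissible.kernel_apply, H.leftInverse z]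
  have := H.admissible.isProbabilityMeasure_gibbs z
  simp [baryMap]

/-- Under every martingale coupling the logarithmic density of the Gibbs plan has the same mean,
which is the value of the dual problem. -/
lemma integral_exponent (H : OptimalPotential μ ν η ψ h) {m : Measure (Rd d × Rd d)}
    (hm : IsMartingaleCoupling μ ν m) :
    Integrable (fun p => gibbsExponent ν ψ (h p.1, p.2)) m ∧
      ∫ p, gibbsExponent ν ψ (h p.1, p.2) ∂m =
        ∫ y, ψ y ∂ν + ∫ x, (⟪h x, x⟫ - logZ ν ψ (h x)) ∂μ := by
  obtain ⟨hi, hval⟩ := hm.integral_inner H.isP2_first H.isP2_second H.measurable_inverse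
    H.memLp_inverse
  have h1 := hm.1.integrable_comp_snd H.integrable_potential
  have h12 : Integrable (fun p : Rd d × Rd d => ψ p.2 + ⟪h p.1, p.2⟫) m := h1.add hi
  have h3 := hm.1.integrable_comp_fst H.integrable_logZ_inverse
  refine ⟨h12.sub h3, ?_⟩
  simp only [gibbsExponent]
  rw [integral_sub h12 h3, integral_add h1 hi, hval,
    hm.1.integral_comp_fst H.integrable_logZ_inverse, hm.1.integral_comp_snd H.integrable_potential,
    integral_sub H.integrable_inner_inverse H.integrable_logZ_inverse]
  ring

/-- The plan attains the Gibbs lower bound for the relative entropy of martingale couplings. -/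
lemma attainsP (H : OptimalPotential μ ν η ψ h) :
    AttainsP μ ν (μ ⊗ₘ H.admissible.kernel H.measurable_inverse) := by
  have := H.isP2_first.1
  have := H.isP2_second.1
  refine ⟨H.isMartingaleCoupling, fun m' hm' => ?_⟩
  have := hm'.1.isProbabilityMeasure
  obtain ⟨hi, hval⟩ := H.integral_exponent H.isMartingaleCoupling
  obtain ⟨hi', hval'⟩ := H.integral_exponent hm'
  have hexp := H.admissible.integrable_exp_exponent (η := μ) H.measurable_inverse
  have h1 := H.admissible.integral_exp_exponent (η := μ) H.measurable_inverse
  have htilt := H.admissible.tilted_eq_compProd (η := μ) H.measurable_inverse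
  rw [← htilt] at hi hval ⊢
  rw [← EReal.coe_ennreal_le_coe_ennreal_iff, klDiv_tilted_self hexp h1 hi, hval, ← hval']
  exact integral_le_klDiv hexp h1 hi'

end OptimalPotential

/-! ### The dual problem -/

section EIntegral

variable {μ : Measure (Rd d)}

lemma eintegral_mono_ae {f g : Rd d → EReal} (h : ∀ᵐ x ∂μ, f x ≤ g x) :
    eintegral μ f ≤ eintegral μ g := by
  refine EReal.sub_le_sub ?_ ?_ <;> rw [EReal.coe_ennreal_le_coe_ennreal_iff]
  · exact lintegral_mono_ae (h.mono fun x hx => EReal.toENNReal_le_toENNReal hx)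
  · exact lintegral_mono_ae (h.mono fun x hx =>
      EReal.toENNReal_le_toENNReal (EReal.neg_le_neg_iff.2 hx))

lemma eintegral_coe {f : Rd d → ℝ} (hf : Integrable f μ) :
    eintegral μ (fun x => (f x : EReal)) = ((∫ x, f x ∂μ : ℝ) : EReal) := by
  have h1 : ∫⁻ x, ENNReal.ofReal (f x) ∂μ ≠ ⊤ := hf.lintegral_lt_top.ne
  have h2 : ∫⁻ x, ENNReal.ofReal (-f x) ∂μ ≠ ⊤ := hf.neg.lintegral_lt_top.ne
  simp only [eintegral, ← EReal.coe_neg, EReal.real_coe_toENNReal]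
  rw [integral_eq_lintegral_pos_part_sub_lintegral_neg_part hf, EReal.coe_sub,
    EReal.coe_ennreal_toReal h1, EReal.coe_ennreal_toReal h2]

end EIntegral

/-- Jensen's inequality for the exponential function, in a form that allows an infinite right-hand
side. -/
lemma integral_le_log_lintegral_exp {α : Type*} [MeasurableSpace α] {Q : Measure α}
    [IsProbabilityMeasure Q] {s : α → ℝ} (hs : Integrable s Q) :
    ((∫ a, s a ∂Q : ℝ) : EReal) ≤
      ENNReal.log (∫⁻ a, ENNReal.ofReal (Real.exp (s a)) ∂Q) := by
  by_cases htop : ∫⁻ a, ENNReal.ofReal (Real.exp (s a)) ∂Q = ⊤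
  · simp [htop]
  · have hexp : Integrable (fun a => Real.exp (s a)) Q := by
      refine ⟨Real.continuous_exp.comp_aestronglyMeasurable hs.1, ?_⟩
      rw [hasFiniteIntegral_iff_ofReal (Filter.Eventually.of_forall fun a => (Real.exp_pos _).le)]
      exact lt_top_iff_ne_top.2 htop
    rw [← ofReal_integral_eq_lintegral_ofReal hexp
        (Filter.Eventually.of_forall fun a => (Real.exp_pos _).le),
      ENNReal.log_ofReal_of_pos (integral_exp_pos hexp), EReal.coe_le_coe_iff,
      Real.le_log_iff_exp_le (integral_exp_pos hexp)]
    exact convexOn_exp.map_integral_le Real.continuous_exp.continuousOn isClosed_univ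
      (Filter.Eventually.of_forall fun a => mem_univ _) hs hexp

namespace Admissible

variable {ν : Measure (Rd d)} {ψ : Rd d → ℝ}

lemma innerObj_eq (hψ : Admissible ν ψ) (x a : Rd d) :
    innerObj ν ψ x a = ((⟪a, x⟫ - logZ ν ψ a : ℝ) : EReal) := by
  rw [innerObj, hψ.logPartition_eq, EReal.coe_sub]

lemma innerObj_baryMap_le (hψ : Admissible ν ψ) (hν : NotOnHyperplane ν) (z a : Rd d) :
    innerObj ν ψ (baryMap ν ψ z) a ≤ innerObj ν ψ (baryMap ν ψ z) z := by
  have h := hψ.logZ_add_inner_le hν a z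
  rw [hψ.innerObj_eq, hψ.innerObj_eq, EReal.coe_le_coe_iff]
  rw [inner_sub_left] at h
  linarith

/-- At a barycenter the inner problem has a unique maximizer. -/
lemma eq_of_innerObj_baryMap_le (hψ : Admissible ν ψ) (hν : NotOnHyperplane ν) {z a : Rd d}
    (h : innerObj ν ψ (baryMap ν ψ z) z ≤ innerObj ν ψ (baryMap ν ψ z) a) : a = z := by
  by_contra hne
  have h1 := hψ.logZ_add_inner_lt hν hne
  rw [hψ.innerObj_eq, hψ.innerObj_eq, EReal.coe_le_coe_iff] at h
  rw [inner_sub_left] at h1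
  linarith

lemma iSup_innerObj_baryMap (hψ : Admissible ν ψ) (hν : NotOnHyperplane ν) (z : Rd d) :
    ⨆ a, innerObj ν ψ (baryMap ν ψ z) a = ((⟪z, baryMap ν ψ z⟫ - logZ ν ψ z : ℝ) : EReal) := by
  rw [← hψ.innerObj_eq]
  exact le_antisymm (iSup_le fun a => hψ.innerObj_baryMap_le hν z a)
    (le_iSup (fun a => innerObj ν ψ (baryMap ν ψ z) a) z)

/-- Weak duality for the inner problem: at the barycenter of a Gibbs measure of `ψ`, replacing `ψ`
by `ψ'` raises the inner value by at most the mean of `ψ - ψ'` under that measure. This is Jensen's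
inequality for the Gibbs measure. -/
lemma innerObj_le_add_integral (hψ : Admissible ν ψ) {ψ' : Rd d → ℝ} {z : Rd d}
    (hi : Integrable ψ (gibbs ν ψ z)) (hi' : Integrable ψ' (gibbs ν ψ z)) (a : Rd d) :
    innerObj ν ψ' (baryMap ν ψ z) a ≤
      ((⟪z, baryMap ν ψ z⟫ - logZ ν ψ z + (∫ y, ψ y ∂(gibbs ν ψ z) -
        ∫ y, ψ' y ∂(gibbs ν ψ z)) : ℝ) : EReal) := by
  have := hψ.isProbabilityMeasure_gibbs z
  have hin : Integrable (fun y => ⟪a - z, y⟫) (gibbs ν ψ z) :=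
    hψ.integrable_gibbs (expGrowth_inner_left _) z
  have h1 : Integrable (fun y => ψ' y - ψ y) (gibbs ν ψ z) := hi'.sub hi
  have h2 : Integrable (fun y => ψ' y - ψ y + ⟪a - z, y⟫) (gibbs ν ψ z) := h1.add hin
  have hJ := integral_le_log_lintegral_exp (s := fun y => ψ' y - ψ y + ⟪a - z, y⟫ + logZ ν ψ z)
    (h2.add (integrable_const _))
  rw [integral_add h2 (integrable_const _), integral_add h1 hin, integral_sub hi' hi,
    hψ.integral_inner_gibbs] at hJ
  simp only [integral_const, probReal_univ, smul_eq_mul, one_mul] at hJ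
  have e : ∫⁻ y, ENNReal.ofReal (Real.exp (ψ' y - ψ y + ⟪a - z, y⟫ + logZ ν ψ z)) ∂(gibbs ν ψ z) =
      ∫⁻ y, ENNReal.ofReal (Real.exp (ψ' y + ⟪a, y⟫)) ∂ν := by
    rw [gibbs, lintegral_tilted]
    congr 1 with y
    rw [← hψ.exp_logZ, ← Real.exp_sub, ← ENNReal.ofReal_mul (Real.exp_pos _).le, ← Real.exp_add,
      inner_sub_left]
    ring_nf
  rw [e] at hJ
  rw [innerObj, logPartition]
  refine (EReal.sub_le_sub le_rfl hJ).trans ?_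
  rw [← EReal.coe_sub, EReal.coe_le_coe_iff, inner_sub_left]
  linarith

/-- A lower bound for the log-partition function by Jensen's inequality for `ν`. -/
lemma integral_add_inner_le_logZ (hψ : Admissible ν ψ) (hi : Integrable ψ ν)
    (hν : Integrable (fun y : Rd d => y) ν) (a : Rd d) :
    ∫ y, ψ y ∂ν + ⟪a, ∫ y, y ∂ν⟫ ≤ logZ ν ψ a := by
  have := hψ.prob
  have hin : Integrable (fun y => ⟪a, y⟫) ν := hν.const_inner a
  have h : Integrable (fun y => ψ y + ⟪a, y⟫) ν := hi.add hin
  have hJ := integral_le_log_lintegral_exp h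
  rw [integral_add hi hin, integral_inner hν] at hJ
  have := hψ.logPartition_eq a
  rw [logPartition] at this
  rwa [this, EReal.coe_le_coe_iff] at hJ

/-- Dominated convergence for the log-partition function. -/
lemma tendsto_logZ (hψ : Admissible ν ψ) {G : Rd d → ℝ} (hG : Admissible ν G) {g : ℕ → Rd d → ℝ}
    (hg : ∀ n, Measurable (g n)) (hle : ∀ n y, g n y ≤ G y)
    (hlim : ∀ᵐ y ∂ν, Filter.Tendsto (fun n => g n y) Filter.atTop (nhds (ψ y))) (a : Rd d) :
    Filter.Tendsto (fun n => logZ ν (g n) a) Filter.atTop (nhds (logZ ν ψ a)) := by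
  refine Filter.Tendsto.log ?_ (hψ.integral_weight_pos a).ne'
  refine tendsto_integral_of_dominated_convergence _
    (fun n => ((hg n).add (by fun_prop)).exp.aestronglyMeasurable) (hG.integrable_weight a)
    (fun n => Filter.Eventually.of_forall fun y => ?_) (hlim.mono fun y hy => ?_)
  · rw [Real.norm_of_nonneg (Real.exp_pos _).le]
    gcongr
    exact hle n y
  · exact (Real.continuous_exp.tendsto _).comp (hy.add_const _)

lemma logZ_mono (hψ : Admissible ν ψ) {G : Rd d → ℝ} (hG : Admissible ν G)
    (hle : ∀ y, ψ y ≤ G y) (a : Rd d) : logZ ν ψ a ≤ logZ ν G a := by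
  refine Real.log_le_log (hψ.integral_weight_pos a)
    (integral_mono (hψ.integrable_weight a) (hG.integrable_weight a) fun y => ?_)
  have := hle y
  simp only
  gcongr

end Admissible

/-- An integrable function below a continuous nonnegative one is the limit, almost everywhere and in
the mean, of bounded continuous functions below the same bound. -/
lemma exists_seq_boundedContinuous {ν : Measure (Rd d)} [IsFiniteMeasure ν] {ψ G : Rd d → ℝ}
    (hi : Integrable ψ ν) (hG : Continuous G) (hG0 : ∀ y, 0 ≤ G y) (hle : ∀ᵐ y ∂ν, ψ y ≤ G y) :
    ∃ g : ℕ → Rd d →ᵇ ℝ, (∀ n y, g n y ≤ G y) ∧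
      Filter.Tendsto (fun n => ∫ y, g n y ∂ν) Filter.atTop (nhds (∫ y, ψ y ∂ν)) ∧
      ∀ᵐ y ∂ν, Filter.Tendsto (fun n => g n y) Filter.atTop (nhds (ψ y)) := by
  have hex : ∀ n : ℕ, ∃ f : Rd d →ᵇ ℝ, eLpNorm (ψ - ⇑f) 1 ν ≤ ((n : ℝ≥0∞) + 1)⁻¹ ∧ MemLp (⇑f) 1 ν :=
    fun n => (memLp_one_iff_integrable.2 hi).exists_boundedContinuous_eLpNorm_sub_le
      ENNReal.one_ne_top (by simp)
  choose f hf hfi using hex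
  -- Truncation at `G` does not increase the distance to `ψ`, since `ψ` is below `G`.
  let g : ℕ → Rd d →ᵇ ℝ := fun n => BoundedContinuousFunction.ofNormedAddCommGroup
    (fun y => min (f n y) (G y)) ((f n).continuous.min hG) ‖f n‖ fun y => by
      have h1 := abs_le.1 ((f n).norm_coe_le_norm y)
      rw [Real.norm_eq_abs, abs_le]
      exact ⟨le_min h1.1 (by linarith [hG0 y, norm_nonneg (f n)]), (min_le_left _ _).trans h1.2⟩
  have hgi : ∀ n, Integrable (g n) ν := fun n => (g n).integrable ν
  have hgn : ∀ n, eLpNorm (⇑(g n) - ψ) 1 ν ≤ ((n : ℝ≥0∞) + 1)⁻¹ := fun n => by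
    refine le_trans (eLpNorm_mono_ae (hle.mono fun y hy => ?_)) (hf n)
    simp only [Pi.sub_apply]
    have h1 : g n y - ψ y = min (f n y) (G y) - min (ψ y) (G y) := by rw [min_eq_left hy]; rfl
    rw [h1, Real.norm_eq_abs, Real.norm_eq_abs, abs_sub_comm (ψ y)]
    simpa using abs_min_sub_min_le_max (f n y) (G y) (ψ y) (G y)
  have hlim : Filter.Tendsto (fun n => eLpNorm (⇑(g n) - ψ) 1 ν) Filter.atTop (nhds 0) := by
    refine tendsto_of_tendsto_of_tendsto_of_le_of_le tendsto_const_nhds ?_ (fun n => zero_le) hgn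
    have h1 : Filter.Tendsto (fun n : ℕ => ((n : ℝ≥0∞) + 1)) Filter.atTop (nhds ⊤) :=
      Filter.Tendsto.add_const _ ENNReal.tendsto_nat_nhds_top
    simpa using tendsto_inv_iff.2 h1
  obtain ⟨ns, hns, hae⟩ := (tendstoInMeasure_of_tendsto_eLpNorm one_ne_zero
    (fun n => (hgi n).1) hi.1 hlim).exists_seq_tendsto_ae
  refine ⟨fun n => g (ns n), fun n y => min_le_right _ _, ?_, hae⟩
  exact (tendsto_integral_of_L1' ψ hi.1 (Filter.Eventually.of_forall hgi) hlim).comp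
    hns.tendsto_atTop

namespace OptimalPotential

variable {μ ν η : Measure (Rd d)} {ψ : Rd d → ℝ} {h : Rd d → Rd d}

/-- The dual value of `ψ` is the common mean of `OptimalPotential.integral_exponent`. -/
lemma dualFun_eq (H : OptimalPotential μ ν η ψ h) :
    dualFun μ ν ψ =
      ((∫ y, ψ y ∂ν + ∫ x, (⟪h x, x⟫ - logZ ν ψ (h x)) ∂μ : ℝ) : EReal) := by
  have hi : Integrable (fun x => ⟪h x, x⟫ - logZ ν ψ (h x)) μ :=
    H.integrable_inner_inverse.sub H.integrable_logZ_inverse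
  have hae : ∀ᵐ x ∂μ, ⨆ a, innerObj ν ψ x a = ((⟪h x, x⟫ - logZ ν ψ (h x) : ℝ) : EReal) :=
    H.ae_of_forall_baryMap fun z => by
      rw [H.admissible.iSup_innerObj_baryMap H.notOnHyperplane, H.leftInverse z]
  rw [dualFun, EReal.coe_add, ← eintegral_coe hi]
  congr 1
  exact le_antisymm (eintegral_mono_ae (hae.mono fun x hx => hx.le))
    (eintegral_mono_ae (hae.mono fun x hx => hx.ge))

/-- No integrable potential has a larger dual value. The pointwise bounds for the inner problems
are integrated with respect to `μ`; since the plan has second marginal `ν`, the mean changes of the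
potential add up to the change of the first term of the dual functional. -/
lemma dualFun_le (H : OptimalPotential μ ν η ψ h) {ψ' : Rd d → ℝ} (hi' : Integrable ψ' ν) :
    dualFun μ ν ψ' ≤ dualFun μ ν ψ := by
  have := H.isP2_first.1
  have hc := H.isCoupling_baryPlan
  have hi1 := hc.integrable_comp_snd H.integrable_potential
  have hi2 := hc.integrable_comp_snd hi'
  have hae1 := ((Measure.integrable_compProd_iff hi1.1).1 hi1).1
  have hae2 := ((Measure.integrable_compProd_iff hi2.1).1 hi2).1
  have hm1 : Integrable (fun x => ∫ y, ψ y ∂(gibbs ν ψ (h x))) μ := hi1.integral_compProd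
  have hm2 : Integrable (fun x => ∫ y, ψ' y ∂(gibbs ν ψ (h x))) μ := hi2.integral_compProd
  have hm : Integrable (fun x => ∫ y, ψ y ∂(gibbs ν ψ (h x)) - ∫ y, ψ' y ∂(gibbs ν ψ (h x))) μ :=
    hm1.sub hm2
  have e1 := (Measure.integral_compProd hi1).symm.trans
    (hc.integral_comp_snd H.integrable_potential)
  have e2 := (Measure.integral_compProd hi2).symm.trans (hc.integral_comp_snd hi')
  simp only [Admissible.kernel_apply] at hae1 hae2 e1 e2
  have hf : Integrable (fun x => ⟪h x, x⟫ - logZ ν ψ (h x)) μ :=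
    H.integrable_inner_inverse.sub H.integrable_logZ_inverse
  have hbound : ∀ᵐ x ∂μ, ⨆ a, innerObj ν ψ' x a ≤ ((⟪h x, x⟫ - logZ ν ψ (h x) +
      (∫ y, ψ y ∂(gibbs ν ψ (h x)) - ∫ y, ψ' y ∂(gibbs ν ψ (h x))) : ℝ) : EReal) := by
    filter_upwards [hae1, hae2, H.ae_of_forall_baryMap (p := fun x => baryMap ν ψ (h x) = x)
      fun z => by rw [H.leftInverse z]] with x h1 h2 h3
    refine iSup_le fun a => ?_
    have := H.admissible.innerObj_le_add_integral h1 h2 a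
    rwa [h3] at this
  rw [H.dualFun_eq, dualFun]
  refine (add_le_add le_rfl (eintegral_mono_ae hbound)).trans ?_
  have hfm : Integrable (fun x => ⟪h x, x⟫ - logZ ν ψ (h x) +
      (∫ y, ψ y ∂(gibbs ν ψ (h x)) - ∫ y, ψ' y ∂(gibbs ν ψ (h x)))) μ := hf.add hm
  rw [eintegral_coe hfm, ← EReal.coe_add, EReal.coe_le_coe_iff, integral_add hf hm,
    integral_sub hm1 hm2, e1, e2]
  linarith

/-- There is no duality gap: `ψ` is approximated by bounded continuous potentials with a common bound of
linear growth from above, and dominated convergence applies to the inner objectives at `0` and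
at `h x`. -/
lemma dualFun_le_dualValue (H : OptimalPotential μ ν η ψ h) :
    dualFun μ ν ψ ≤ dualValue μ ν := by
  have hμ := H.isP2_first.1
  have hν := H.isP2_second.1
  have hψ := H.admissible
  obtain ⟨C, K, hC, hK, hgrowth⟩ := hψ.growth
  set G : Rd d → ℝ := fun y => C + K * ‖y‖ with hGdef
  have hGc : Continuous G := by fun_prop
  have hG : Admissible ν G := ⟨hν, hψ.expMoments, hGc.measurable, C, K, hC, hK,
    Filter.Eventually.of_forall fun y => le_rfl⟩
  obtain ⟨g, hgG, hgint, hgae⟩ := exists_seq_boundedContinuous H.integrable_potential hGc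
    (fun y => by positivity) hgrowth
  have hg : ∀ n, Admissible ν (g n) := fun n => ⟨hν, hψ.expMoments, (g n).continuous.measurable,
    ‖g n‖, 0, norm_nonneg _, le_rfl, Filter.Eventually.of_forall fun y => by
      simpa using (le_abs_self _).trans ((g n).norm_coe_le_norm y)⟩
  have hid : Integrable (fun y : Rd d => y) ν := H.isP2_second.2.integrable one_le_two
  -- Testing the inner problem with `0` bounds it from below by `-b`, as `g n` is below `G`.
  set b := logZ ν G 0 with hb
  set e := ∫ y, y ∂ν with he
  obtain ⟨B, hB⟩ := (Metric.isBounded_range_of_tendsto _ hgint).exists_norm_le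
  have hB' : ∀ n, |∫ y, g n y ∂ν| ≤ B := fun n => hB _ (mem_range_self n)
  set f : ℕ → Rd d → ℝ := fun n x => max (-b) (⟪h x, x⟫ - logZ ν (g n) (h x)) with hf
  have hfm : ∀ n, AEStronglyMeasurable (f n) μ := fun n =>
    (measurable_const.max ((H.measurable_inverse.inner measurable_id).sub
      ((hg n).measurable_logZ.comp H.measurable_inverse))).aestronglyMeasurable
  set bound : Rd d → ℝ := fun x => |b| + (|⟪h x, x⟫| + B + ‖h x‖ * ‖e‖) with hbound
  have hh1 : Integrable (fun x => ‖h x‖) μ := (H.memLp_inverse.integrable one_le_two).norm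
  have hbi : Integrable bound μ :=
    (integrable_const _).add ((H.integrable_inner_inverse.abs.add (integrable_const _)).add
      (hh1.mul_const _))
  have hle : ∀ n x, ‖f n x‖ ≤ bound x := fun n x => by
    -- Jensen's inequality for `ν` bounds the objective at `h x` from above, uniformly in `n`.
    have h1 := (hg n).integral_add_inner_le_logZ ((g n).integrable ν) hid (h x)
    have h2 := (abs_le.1 (abs_real_inner_le_norm (h x) e)).1
    have h3 := (abs_le.1 (hB' n)).1
    have h4 := le_abs_self ⟪h x, x⟫
    have h5 := abs_nonneg ⟪h x, x⟫
    have h6 : 0 ≤ B := (abs_nonneg _).trans (hB' n)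
    have h7 : 0 ≤ ‖h x‖ * ‖e‖ := by positivity
    have h8 := neg_abs_le b
    have h9 := le_abs_self b
    rw [Real.norm_eq_abs, abs_le]
    simp only [hf, hbound]
    refine ⟨le_trans (by linarith) (le_max_left _ _), max_le (by linarith) (by linarith)⟩
  have hfi : ∀ n, Integrable (f n) μ := fun n =>
    hbi.mono' (hfm n) (Filter.Eventually.of_forall (hle n))
  have hflim : Filter.Tendsto (fun n => ∫ x, f n x ∂μ) Filter.atTop
      (nhds (∫ x, max (-b) (⟪h x, x⟫ - logZ ν ψ (h x)) ∂μ)) := by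
    refine tendsto_integral_of_dominated_convergence bound hfm hbi
      (fun n => Filter.Eventually.of_forall (hle n)) (Filter.Eventually.of_forall fun x => ?_)
    exact tendsto_const_nhds.max (tendsto_const_nhds.sub
      (hψ.tendsto_logZ hG (fun n => (g n).continuous.measurable) hgG hgae (h x)))
  have hdual : ∀ n, ((∫ y, g n y ∂ν + ∫ x, f n x ∂μ : ℝ) : EReal) ≤ dualValue μ ν := fun n => by
    refine le_trans ?_ (le_iSup (fun ψ : Rd d →ᵇ ℝ => dualFun μ ν ψ) (g n))
    simp only [dualFun]
    rw [EReal.coe_add, ← eintegral_coe (hfi n)]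
    refine add_le_add le_rfl (eintegral_mono_ae (Filter.Eventually.of_forall fun x => ?_))
    rw [EReal.coe_strictMono.monotone.map_max]
    refine max_le (le_trans ?_ (le_iSup (fun a => innerObj ν (g n) x a) 0))
      (le_trans ?_ (le_iSup (fun a => innerObj ν (g n) x a) (h x)))
    · rw [(hg n).innerObj_eq, EReal.coe_le_coe_iff, inner_zero_left]
      linarith [(hg n).logZ_mono hG (hgG n) 0]
    · rw [(hg n).innerObj_eq]
  have hlim := le_of_tendsto' (EReal.tendsto_coe.2 (hgint.add hflim)) hdual
  refine le_trans ?_ hlim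
  rw [H.dualFun_eq, EReal.coe_le_coe_iff]
  have hi : Integrable (fun x => ⟪h x, x⟫ - logZ ν ψ (h x)) μ :=
    H.integrable_inner_inverse.sub H.integrable_logZ_inverse
  have := integral_mono hi ((integrable_const (-b)).sup hi) fun x => le_max_right (-b) _
  exact add_le_add le_rfl this

lemma attainsD (H : OptimalPotential μ ν η ψ h) : AttainsD μ ν ψ := by
  have := H.isP2_second.1
  refine ⟨H.integrable_potential, le_antisymm H.dualFun_le_dualValue ?_, fun ψ' => H.dualFun_le⟩
  exact iSup_le fun g => H.dualFun_le (g.integrable ν)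

end OptimalPotential

end MartingaleSB

/-! ### Optimality of the Gibbs plan and of its potential -/

open MartingaleSB in
theorem mainTheorem1 {d : ℕ} (μ ν : Measure (Rd d)) (hμ : IsP2 μ) (hν : IsP2 ν)
    (hμν : ConvexOrder μ ν) (hexp : HasExpMoments ν) (hplane : NotOnHyperplane ν)
    (hfin : vpValue μ ν ≠ ⊥ ∧ vpValue μ ν ≠ ⊤)
    (μbar : Measure (Rd d)) (hμbar : SolvesVP μ ν μbar)
    (π : Measure (Rd d × Rd d)) [IsProbabilityMeasure π] (hπ : SolvesSP μbar ν π)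
    (φ₀ ψ : Rd d → ℝ) (hpot : IsSchrodingerPotentials μbar ν φ₀ ψ) :
    -- the everywhere defined versions of the first potential and of the disintegration of `π`
    (∀ᵐ x ∂μbar, extPotential ν ψ x = (φ₀ x : EReal)) ∧
    (∀ᵐ x ∂μbar, π.condKernel x = gibbs ν ψ x) ∧
    -- (1)
    (∀ x, extPotential ν ψ x ≠ ⊥ ∧ extPotential ν ψ x ≠ ⊤) ∧
    StrictConcaveOn ℝ univ (fun x => (extPotential ν ψ x).toReal) ∧
    ContDiff ℝ ∞ (fun x => (extPotential ν ψ x).toReal) ∧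
    (∀ x, IsProbabilityMeasure (gibbs ν ψ x) ∧ MemLp (fun y : Rd d => y) 2 (gibbs ν ψ x)) ∧
    (∀ x, HasGradientAt (fun x => (extPotential ν ψ x).toReal) (-baryMap ν ψ x) x) ∧
    (∀ x u v, iteratedFDeriv ℝ 2 (fun x => (extPotential ν ψ x).toReal) x ![u, v] =
      -cov[fun y => ⟪u, y⟫, fun y => ⟪v, y⟫; gibbs ν ψ x]) ∧
    Function.Injective (baryMap ν ψ) ∧
    μbar.map (baryMap ν ψ) = μ ∧
    -- (2), for every extension `h` to `ℝ^d` of the inverse of `T` on its range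
    (∀ h : Rd d → Rd d, Function.LeftInverse h (baryMap ν ψ) →
      ∀ᵐ x ∂μ, (baryPlan (baryMap ν ψ) π).condKernel x = gibbs ν ψ (h x)) ∧
    -- (3)
    AttainsP μ ν (baryPlan (baryMap ν ψ) π) ∧
    -- (4)
    AttainsD μ ν ψ ∧
    (∀ h : Rd d → Rd d, Function.LeftInverse h (baryMap ν ψ) →
      ∀ᵐ x ∂μ, (∀ h' : Rd d, innerObj ν ψ x h' ≤ innerObj ν ψ x (h x)) ∧
        ∀ h₁ : Rd d, (∀ h' : Rd d, innerObj ν ψ x h' ≤ innerObj ν ψ x h₁) → h₁ = h x) := by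
  have hη := hμbar.1
  have hηp := hη.1
  have hψ := hpot.admissible hν.1 hexp
  obtain ⟨hiψ, hiL⟩ := hpot.integrable hψ hη hν
  have hplan := hπ.eq_compProd hpot hψ hη hν
  have hTη := hμbar.map_baryMap hψ hplane hν hμ hiψ hiL (hpot.spValue_eq hψ hη hν)
  obtain ⟨h₀, hh₀, hinv⟩ :=
    (hψ.measurableEmbedding_baryMap hplane).exists_measurable_extend measurable_id fun _ => ⟨0⟩
  have H : OptimalPotential μ ν μbar ψ h₀ := ⟨hψ, hplane, hμ, hν, hη, hiψ, hiL,
    hpot.isCoupling hψ, hTη, hh₀, congrFun hinv⟩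
  have hbary : baryPlan (baryMap ν ψ) π = μ ⊗ₘ hψ.kernel hh₀ := by rw [hplan]; exact H.baryPlan_eq
  have hpotential : (fun x => (extPotential ν ψ x).toReal) = -logZ ν ψ := by
    ext x; rw [hψ.extPotential_eq]; rfl
  have hker : ∀ᵐ x ∂μbar, π.condKernel x = gibbs ν ψ x := by
    have h1 := eq_condKernel_of_measure_eq_compProd (ρ := π) (hψ.kernel measurable_id)
      (by rw [hπ.1.1]; exact hplan)
    rw [hπ.1.1] at h1
    exact h1.mono fun x hx => hx.symm
  refine ⟨?_, hker, ?_, ?_, ?_, ?_, ?_, ?_, hψ.injective_baryMap hplane, hTη, ?_, ?_, H.attainsD,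
    ?_⟩
  · filter_upwards [hpot.ae_eq_neg_logZ hψ] with x hx
    rw [hψ.extPotential_eq, hx]
  · intro x
    rw [hψ.extPotential_eq]
    exact ⟨EReal.coe_ne_bot _, EReal.coe_ne_top _⟩
  · rw [hpotential]
    exact (hψ.strictConvexOn_logZ hplane).neg
  · rw [hpotential]
    exact hψ.contDiff_logZ.neg
  · exact fun x => ⟨hψ.isProbabilityMeasure_gibbs x, hψ.memLp_id_gibbs x⟩
  · intro x
    rw [hpotential]
    have hgrad := (hψ.hasGradientAt_logZ x).hasFDerivAt.neg
    rw [← map_neg] at hgrad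
    exact hasGradientAt_iff_hasFDerivAt.2 hgrad
  · intro x u v
    rw [hpotential, iteratedFDeriv_neg_apply, neg_apply,
      hψ.iteratedFDeriv_two_logZ]
  · exact fun h hh => H.condKernel_eq_gibbs hbary hh
  · rw [hbary]
    exact H.attainsP
  · intro h hh
    refine H.ae_of_forall_baryMap fun z => ?_
    rw [hh z]
    exact ⟨hψ.innerObj_baryMap_le hplane z, fun a ha =>
      hψ.eq_of_innerObj_baryMap_le hplane (ha z)⟩
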